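/- Conventions. All graphs are finite and simple. An instance of 2-DRP is a graph $G$ with four distinct vertices $s_1,s_2,t_1,t_2$ (terminals). Let $G'$ be obtained from $G$ by adding a new vertex $v^*$ joined to the four terminals and the edges $s_1s_2,s_2t_1,t_1t_2,t_2s_1$, and let $C=\{v^*,s_1,s_2,t_1,t_2\}$. Repeatedly delete vertices separated from $C$ by a cutset of size at most $1$ until this is no longer possible, which leaves the block $B$ of $G'$ containing the added edges; then repeatedly take a cutset $X$ of size $2$ and a component $U$ of the current graph minus $X$ with $U\cap C=\emptyset$, delete $U$ and join the two vertices of $X$ by an edge, until no such $X,U$ exist. The resulting graph $T$ is a *root graph* with root vertices $C$. A *compaction* of $T$ is a 3-connected minor of $T$ in which the five vertices of $C$ have been contracted into different vertices (again denoted $v^*,s_1,s_2,t_1,t_2$, and their set by $C$) and in which no edge of $T$ with both endpoints in $C$ has been deleted. Let $H$ be a 3-connected graph containing the vertices of $C$ and the added edges between them (such as a root graph, a compaction of one, or a reduction of one). A *reduction* of $H$ is a 3-connected graph $J$ with $C\subseteq V(J)\subseteq V(H)$ such that for every component $U$ of $H-V(J)$ the set $S(U)$ of vertices of $J$ with a neighbour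 in $U$ (the *separator* of $U$; we say that $U$ *attaches at* $S(U)$) is a triangle of $J$, and such that $xy\in E(J)$ exactly when $x,y$ are distinct vertices of $J$ with $xy\in E(H)$ or $x,y\in S(U)$ for some component $U$ of $H-V(J)$. A *strong planar reduction* of $H$ is a reduction $J$ that is planar and such that in the planar embedding of $J$ (unique, as $J$ is 3-connected) every separator is the vertex set of a triangular face. It is *ferociously strong* if, for every separator $X$, either two different components of $H-V(J)$ have separator $X$, or the vertices of the unique component with separator $X$ can be partitioned into two sets each of which induces a connected subgraph and has an edge to each vertex of $X$. The *centers* of a $K_{3,3}$ subdivision are its six vertices corresponding to the vertices of $K_{3,3}$. Theorem. (1) Let $F$ be a compaction of a root graph, let $F$ contain a $K_{3,3}$ subdivision, and let $J$ be a strong planar reduction of $F$. Then there is a set $X$ that is the vertex set of a triangular face of $J$ such that at least five of the six centers of the subdivision lie in the union of $X$ and those components of $F-V(J)$ that attach at $X$. (2) Let $F$ be a reduction or a compaction of a root graph, and let $F$ contain a $K_{3,3}$ subdivision having $v^*$ as a center. Let $a,b$ be the two other centers on the same side of the $K_{3,3}$ as $v^*$. Let $A$ and $B$ be vertex-disjoint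 connected subgraphs of $F$ such that the vertices of the subdivision that lie in $A$ (respectively $B$) are exactly $a$ (respectively $b$) and the interior vertices of the three paths of the subdivision ending at $a$ (respectively $b$). Then for any strong planar reduction $J$ of $F$ there is a triangular face of $J$, with vertex set $X$, such that each of $A$ and $B$ is contained in a component of $F-V(J)$ whose separator is $X$ (possibly two different components). (3) Let $H$ be a reduction or a compaction of a root graph, and let $J$ be a ferociously strong planar reduction of $H$. Then $J$ is a strong planar reduction of $H$, and $V(J')\subseteq V(J)$ for every strong planar reduction $J'$ of $H$. -/

import Mathlib

universe u v

namespace TwoDRP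

/-- A simple graph whose vertex set `verts` is a subset of the ambient type `V`. -/
abbrev VGraph (V : Type u) : Type u := (⊤ : SimpleGraph V).Subgraph

section Basic

variable {V : Type u}

/-- `U` is the vertex set of a connected component of `K`. -/
def IsComponent (K : VGraph V) (U : Set V) : Prop :=
  ∃ c : K.coe.ConnectedComponent, U = Subtype.val '' c.supp

/-- More than three vertices, and no deletion of at most two vertices disconnects the graph. -/
def IsThreeConnected (K : VGraph V) : Prop :=
  3 < K.verts.ncard ∧ ∀ S : Set V, S.ncard ≤ 2 → (K.deleteVerts S).Connected

end Basic

/-! ### The auxiliary graph of an instance of 2-DRP and its root graphs -/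

/-- Labels of the five root vertices: the new vertex `v*` and the four terminals. -/
inductive Root : Type
  | vstar
  | s₁
  | s₂
  | t₁
  | t₂

/-- The edges between root vertices that are added to an instance: `v*` is joined to each
terminal, and the terminals form the 4-cycle `s₁ s₂ t₁ t₂`. -/
def wheel : SimpleGraph Root :=
  SimpleGraph.fromEdgeSet
    {s(Root.vstar, Root.s₁), s(Root.vstar, Root.s₂), s(Root.vstar, Root.t₁), s(Root.vstar, Root.t₂),
      s(Root.s₁, Root.s₂), s(Root.s₂, Root.t₁), s(Root.t₁, Root.t₂), s(Root.t₂, Root.s₁)}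

section RootGraphs

variable {V : Type u}

/-- `G` with four distinct terminals is an instance of 2-DRP, and `C` labels the terminals together
with one new vertex `v*` outside `G`. -/
def IsInstance (G : VGraph V) (C : Root ↪ V) : Prop :=
  C Root.vstar ∉ G.verts ∧ ∀ r, r ≠ Root.vstar → C r ∈ G.verts

/-- The auxiliary graph `G'`. -/
def auxGraph (G : VGraph V) (C : Root ↪ V) : VGraph V where
  verts := G.verts ∪ Set.range C
  Adj x y := G.Adj x y ∨ (wheel.map C).Adj x y
  adj_sub h := by
    rcases h with h | h
    · exact G.adj_sub h
    · exact h.ne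
  edge_vert h := by
    rcases h with h | h
    · exact Or.inl (G.edge_vert h)
    · obtain ⟨a, b, -, rfl, -⟩ := (SimpleGraph.map_adj C wheel _ _).1 h
      exact Or.inr ⟨a, rfl⟩
  symm := ⟨fun _ _ h => h.imp (fun h => h.symm) (fun h => h.symm)⟩

/-- Delete the vertices of `U` and make the vertices of `X` pairwise adjacent. -/
def cutOff (K : VGraph V) (U X : Set V) : VGraph V :=
  K.deleteVerts U ⊔ (⊤ : VGraph V).induce X

/-- `U` is a component of `K - X` without root vertices, and every vertex of `X` has a
neighbour in `U`. -/
def IsCutOffBy (K : VGraph V) (C : Root ↪ V) (U X : Set V) : Prop :=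
  X ⊆ K.verts ∧ IsComponent (K.deleteVerts X) U ∧ Disjoint U (Set.range C) ∧
    ∀ x ∈ X, ∃ a ∈ U, K.Adj a x

/-- One deletion of a piece that is cut off from the root vertices by at most one vertex. -/
def BlockStep (C : Root ↪ V) (K K' : VGraph V) : Prop :=
  ∃ U X : Set V, IsCutOffBy K C U X ∧ X.ncard ≤ 1 ∧ K' = K.deleteVerts U

/-- One replacement of a piece that is cut off from the root vertices by a 2-cut: the piece is
deleted and the two vertices of the cut are joined. -/
def TwoCutStep (C : Root ↪ V) (K K' : VGraph V) : Prop :=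
  ∃ U X : Set V, IsCutOffBy K C U X ∧ X.ncard = 2 ∧ K' = cutOff K U X

/-- `T` is a root graph with root vertices `C`: from the auxiliary graph of an instance of 2-DRP,
cutsets of size at most one are used until none is left (which leaves the block `B` containing the
added edges), and then 2-cuts are used until none is left. -/
def IsRootGraph (T : VGraph V) (C : Root ↪ V) : Prop :=
  ∃ G B : VGraph V, IsInstance G C ∧
    Relation.ReflTransGen (BlockStep C) (auxGraph G C) B ∧ (¬ ∃ K, BlockStep C B K) ∧
    Relation.ReflTransGen (TwoCutStep C) B T ∧ (¬ ∃ K, TwoCutStep C T K)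

/-- `F`, with root vertices `D`, is a compaction of `T`, with root vertices `C`: a 3-connected minor
(`branch w` is the set of vertices of `T` contracted to `w`) in which the root vertices are
contracted to different vertices and no edge between root vertices is deleted. -/
def IsCompaction {W : Type v} (T : VGraph V) (C : Root ↪ V) (F : VGraph W) (D : Root ↪ W) :
    Prop :=
  IsThreeConnected F ∧ ∃ branch : W → Set V,
    (∀ w ∈ F.verts, branch w ⊆ T.verts ∧ (T.induce (branch w)).Connected) ∧
    F.verts.PairwiseDisjoint branch ∧
    (∀ w w', F.Adj w w' → ∃ x ∈ branch w, ∃ y ∈ branch w', T.Adj x y) ∧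
    (∀ r, D r ∈ F.verts ∧ C r ∈ branch (D r)) ∧
    (∀ r r', T.Adj (C r) (C r') → F.Adj (D r) (D r'))

/-! ### Reductions -/

/-- The separator `S(U)` of a component `U` of `H - V(J)`: the vertices of `J` with a neighbour
in `U`. -/
def separator (H J : VGraph V) (U : Set V) : Set V :=
  {x | x ∈ J.verts ∧ ∃ a ∈ U, H.Adj a x}

/-- `U` is a component of `H - V(J)`, and it attaches at `X`. -/
def AttachesAt (H J : VGraph V) (U X : Set V) : Prop :=
  IsComponent (H.deleteVerts J.verts) U ∧ separator H J U = X

/-- `J` is a reduction of `H` (with root vertices `C`). -/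
structure IsReduction (H : VGraph V) (C : Root ↪ V) (J : VGraph V) : Prop where
  threeConnected : IsThreeConnected J
  verts_subset : J.verts ⊆ H.verts
  root_mem : ∀ r, C r ∈ J.verts
  triangle : ∀ U X, AttachesAt H J U X →
    ∃ x y z, X = {x, y, z} ∧ J.Adj x y ∧ J.Adj y z ∧ J.Adj x z
  adj_iff : ∀ x y, J.Adj x y ↔ x ∈ J.verts ∧ y ∈ J.verts ∧
    (H.Adj x y ∨ (x ≠ y ∧ ∃ U X, AttachesAt H J U X ∧ x ∈ X ∧ y ∈ X))

/-- `F` is a reduction of some root graph with root vertices `C`. -/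
def IsReductionOfRootGraph (F : VGraph V) (C : Root ↪ V) : Prop :=
  ∃ T : VGraph V, IsRootGraph T C ∧ IsReduction T C F

/-- `F`, with root vertices `D`, is a compaction of some (finite) root graph. -/
def IsCompactionOfRootGraph {W : Type v} (F : VGraph W) (D : Root ↪ W) : Prop :=
  ∃ (V : Type u) (_ : Finite V) (T : VGraph V) (C : Root ↪ V),
    IsRootGraph T C ∧ IsCompaction T C F D

end RootGraphs

/-! ### Planar embeddings -/

/-- A rotation system: `next` is a permutation of the darts which permutes the darts leaving each
vertex in a single cycle (their cyclic order around that vertex). -/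
structure RotationSystem {V : Type u} (G : SimpleGraph V) where
  next : Equiv.Perm G.Dart
  fst_next : ∀ d, (next d).fst = d.fst
  sameCycle : ∀ d d' : G.Dart, d.fst = d'.fst → next.SameCycle d d'

namespace RotationSystem

variable {V : Type u} {G : SimpleGraph V}

/-- The reversal of darts. -/
def flip (G : SimpleGraph V) : Equiv.Perm G.Dart :=
  ⟨SimpleGraph.Dart.symm, SimpleGraph.Dart.symm, SimpleGraph.Dart.symm_symm,
    SimpleGraph.Dart.symm_symm⟩

/-- Facial walks: after the dart from `x` to `y` comes the dart that follows the dart from `y` to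
`x` in the rotation at `y`. The faces are the cycles of this permutation. -/
def faceNext (R : RotationSystem G) : Equiv.Perm G.Dart := (flip G).trans R.next

/-- The number of faces. -/
noncomputable def numFaces (R : RotationSystem G) : ℕ :=
  Nat.card (Quotient (Equiv.Perm.SameCycle.setoid R.faceNext))

end RotationSystem

/-- A planar embedding of a connected finite graph `J` with at least one edge, given
combinatorially: a rotation system of Euler characteristic `2`. -/
structure PlanarEmbedding {V : Type u} (J : VGraph V) extends RotationSystem J.coe where
  connected : J.Connected
  euler : J.verts.ncard + toRotationSystem.numFaces = J.edgeSet.ncard + 2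

/-- `X` is the vertex set of a face of length three. -/
def PlanarEmbedding.IsTriangularFace {V : Type u} {J : VGraph V} (M : PlanarEmbedding J)
    (X : Set V) : Prop :=
  ∃ d : J.coe.Dart,
    M.faceNext (M.faceNext (M.faceNext d)) = d ∧
      X = {(d.fst : V), ((M.faceNext d).fst : V), ((M.faceNext (M.faceNext d)).fst : V)}

section Strong

variable {V : Type u}

/-- `J`, embedded by `M`, is a strong planar reduction of `H`. -/
def IsStrongPlanarReductionWith (H : VGraph V) (C : Root ↪ V) (J : VGraph V)
    (M : PlanarEmbedding J) : Prop :=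
  IsReduction H C J ∧ ∀ U X, AttachesAt H J U X → M.IsTriangularFace X

/-- `J` is a strong planar reduction of `H`. -/
def IsStrongPlanarReduction (H : VGraph V) (C : Root ↪ V) (J : VGraph V) : Prop :=
  ∃ M : PlanarEmbedding J, IsStrongPlanarReductionWith H C J M

/-- `J` is a ferociously strong planar reduction of `H`. -/
def IsFerociouslyStrongPlanarReduction (H : VGraph V) (C : Root ↪ V) (J : VGraph V) : Prop :=
  IsStrongPlanarReduction H C J ∧ ∀ U X, AttachesAt H J U X →
    (∃ U', U' ≠ U ∧ AttachesAt H J U' X) ∨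
    (∃ A B : Set V, A ∪ B = U ∧ Disjoint A B ∧
      (H.induce A).Connected ∧ (H.induce B).Connected ∧
      ∀ x ∈ X, (∃ a ∈ A, H.Adj a x) ∧ (∃ b ∈ B, H.Adj b x))

end Strong

/-! ### Subdivisions of `K₃,₃` -/

/-- A subdivision of `K₃,₃` in `F`: the centers `left i` and `right j` (the two sides), and paths
`path i j` of `F` from `left i` to `right j` that meet only in common endpoints. -/
structure K33Subdivision {V : Type u} (F : VGraph V) where
  left : Fin 3 → V
  right : Fin 3 → V
  path : ∀ i j, F.spanningCoe.Path (left i) (right j)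
  left_injective : Function.Injective left
  right_injective : Function.Injective right
  left_ne_right : ∀ i j, left i ≠ right j
  inter : ∀ i j i' j' x, (i, j) ≠ (i', j') →
    x ∈ (path i j : F.spanningCoe.Walk (left i) (right j)).support →
    x ∈ (path i' j' : F.spanningCoe.Walk (left i') (right j')).support →
    (i = i' ∧ x = left i) ∨ (j = j' ∧ x = right j)

namespace K33Subdivision

variable {V : Type u} {F : VGraph V}

/-- The set of the six centers. -/
def centers (S : K33Subdivision F) : Set V := Set.range S.left ∪ Set.range S.right

/-- The vertex set of the subdivision. -/
def verts (S : K33Subdivision F) : Set V :=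
  {x | ∃ i j, x ∈ (S.path i j : F.spanningCoe.Walk (S.left i) (S.right j)).support}

/-- The center `left i` and the interiors of the three paths that end at it. -/
def openStar (S : K33Subdivision F) (i : Fin 3) : Set V :=
  {x | ∃ j, x ∈ (S.path i j : F.spanningCoe.Walk (S.left i) (S.right j)).support ∧ x ≠ S.right j}

end K33Subdivision

end TwoDRP

/-! Part (1). Contract each component of `F - V(J)` to a new vertex inside the face of `J` at which
it attaches. The resulting map is planar. If paths of the subdivision without a common end always
had disjoint images, this would contradict the nonplanarity of K₃,₃ (`no_K33`). Hence two such paths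
meet the components attaching at one triangle `X` (`exists_paths_meeting_interior`). Only three
vertices separate these components from the rest, and the connectivity of K₃,₃ leaves at most one
center outside (`five_le_ncard_of_meets`).

Images of paths with a common end may overlap, so `no_K33` is proved for mod 2 chains. Planarity
enters only as the vanishing of mod 2 homology, which follows from Euler's formula by counting
dimensions and survives adding a vertex in every face.

Part (2). All neighbours of `v*` are root vertices, and these lie in `J`. So `v*` is in no separator
and in no component: it is the one center missing from (1). Its three paths to the opposite side
cross `X` in three different vertices, which are all of `X`. The connected sets `A` and `B`
therefore avoid `X`, and each stays in one component.

Part (3). Let a component of `H - V(J)` attach at `X`. Ferocity gives two disjoint connected sets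
beyond `X`, each adjacent to all of `X`. A tripod in each and a fan from `v*` to `X` (by Menger's
theorem) form a K₃,₃ subdivision with center `v*`. Applied to `J'`, part (2) shows that both sets
miss `J'`. -/

namespace TwoDRP

/-! ### Combinatorial maps with vanishing mod 2 homology contain no K₃,₃. -/

/-- A combinatorial map: darts with a reversal and a rotation, whose cycles are the sets of darts
leaving the vertices. -/
structure DartSystem (D : Type*) (N : Type*) where
  vert : D → N
  inv : D → D
  rot : Equiv.Perm D
  inv_inv : ∀ d, inv (inv d) = d
  inv_ne : ∀ d, inv d ≠ d
  vert_rot : ∀ d, vert (rot d) = vert d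
  sameCycle : ∀ d d', vert d = vert d' → rot.SameCycle d d'

namespace DartSystem

section

variable {D N : Type*} {M : DartSystem D N}

variable (M) in
lemma vert_rot_pow (t : ℕ) (d : D) : M.vert ((M.rot ^ t) d) = M.vert d := by
  induction t with
  | zero => rfl
  | succ t ih => rw [pow_succ', Equiv.Perm.mul_apply, M.vert_rot, ih]

/-- Invariance under `rot ∘ inv` makes `φ` a function on faces. The darts `rot d` and `inv d` lie on
the same face, so turning past `d` changes `φ` by the value of `c` on `d`. -/
lemma potential_rot {c φ : D → ZMod 2} (h₁ : ∀ d, φ (M.rot (M.inv d)) = φ d)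
    (h₂ : ∀ d, φ d + φ (M.inv d) = c d) (d : D) : φ (M.rot d) = φ d + c d := by
  have h := h₁ (M.inv d)
  rw [M.inv_inv] at h
  rw [h, ← h₂ d, ← add_assoc, CharTwo.add_self_eq_zero, zero_add]

lemma potential_rot_pow {c φ : D → ZMod 2} (h : ∀ d, φ (M.rot d) = φ d + c d) (d : D) (t : ℕ) :
    φ ((M.rot ^ t) d) = φ d + ∑ s ∈ Finset.range t, c ((M.rot ^ s) d) := by
  induction t with
  | zero => simp
  | succ t ih =>
    rw [pow_succ', Equiv.Perm.mul_apply, h, ih, Finset.sum_range_succ, add_assoc]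

lemma potential_const [Finite D] {c φ : D → ZMod 2} (h : ∀ d, φ (M.rot d) = φ d + c d) {n : N}
    (hc : ∀ d, M.vert d = n → c d = 0) {d d' : D} (hd : M.vert d = n) (hd' : M.vert d' = n) :
    φ d = φ d' := by
  obtain ⟨t, rfl⟩ := (M.sameCycle d d' (hd.trans hd'.symm)).exists_nat_pow_eq
  rw [potential_rot_pow h, Finset.sum_eq_zero, add_zero]
  intro s _
  exact hc _ (by rw [vert_rot_pow, hd])

lemma sum_eq_zero_of_pair [Fintype D] {g : D → ZMod 2} (h : ∀ d, g d + g (M.inv d) = 0) : ∑ d, g d = 0 :=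
  Finset.sum_involution (fun d _ => M.inv d) (fun d _ => h d) (fun d _ _ => M.inv_ne d)
    (fun _ _ => Finset.mem_univ _) (fun d _ => M.inv_inv d)

end

section

variable {D N : Type*} [Fintype D] [DecidableEq N] (M : DartSystem D N)

/-- The boundary of a mod 2 chain of darts. -/
def boundary (c : D → ZMod 2) (n : N) : ZMod 2 := ∑ d, if M.vert d = n then c d else 0

/-- The first mod 2 homology vanishes: every cycle is the coboundary of a function on faces. -/
def SimplyConnected : Prop :=
  ∀ c : D → ZMod 2, (∀ d, c (M.inv d) = c d) → (∀ n, M.boundary c n = 0) →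
    ∃ φ : D → ZMod 2, (∀ d, φ (M.rot (M.inv d)) = φ d) ∧ ∀ d, φ d + φ (M.inv d) = c d

variable {M}

lemma boundary_add (c c' : D → ZMod 2) (n : N) :
    M.boundary (c + c') n = M.boundary c n + M.boundary c' n := by
  simp only [boundary, ← Finset.sum_add_distrib]
  refine Finset.sum_congr rfl fun d _ => ?_
  split_ifs <;> simp

lemma boundary_eq_zero {c : D → ZMod 2} {n : N} (h : ∀ d, M.vert d = n → c d = 0) :
    M.boundary c n = 0 := by
  refine Finset.sum_eq_zero fun d _ => ?_
  split_ifs with hd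
  · exact h d hd
  · rfl

lemma boundary_congr {c c' : D → ZMod 2} {n : N} (h : ∀ d, M.vert d = n → c d = c' d) :
    M.boundary c n = M.boundary c' n := by
  refine Finset.sum_congr rfl fun d _ => ?_
  split_ifs with hd
  · exact h d hd
  · rfl

lemma sum_boundary [Fintype N] (c : D → ZMod 2) : ∑ n, M.boundary c n = ∑ d, c d := by
  simp only [boundary]
  rw [Finset.sum_comm]
  simp

variable (M) in
/-- The darts at a vertex can be enumerated in their cyclic order. -/
lemma exists_boundary_eq_sum_range (d₀ : D) :
    ∃ k : ℕ, (M.rot ^ k) d₀ = d₀ ∧ (∀ d, M.vert d = M.vert d₀ → ∃ t < k, (M.rot ^ t) d₀ = d) ∧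
      (∀ t < k, ∀ t' < k, (M.rot ^ t) d₀ = (M.rot ^ t') d₀ → t = t') ∧ ∀ c : D → ZMod 2,
        M.boundary c (M.vert d₀) = ∑ t ∈ Finset.range k, c ((M.rot ^ t) d₀) := by
  classical
  set s : Finset D := Finset.univ.filter fun d => M.vert d = M.vert d₀ with hs
  have hcyc : M.rot.IsCycleOn (s : Set D) := by
    refine ⟨⟨?_, M.rot.injective.injOn, ?_⟩, ?_⟩
    · intro d hd
      simpa [hs, M.vert_rot] using hd
    · intro d hd
      refine ⟨M.rot.symm d, ?_, by simp⟩
      have := M.vert_rot (M.rot.symm d)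
      simp only [Equiv.apply_symm_apply] at this
      simpa [hs, ← this] using hd
    · intro d hd d' hd'
      exact M.sameCycle _ _ (by simp [hs] at hd hd'; rw [hd, hd'])
  have hd₀ : d₀ ∈ s := by simp [hs]
  have hsurj : ∀ d, M.vert d = M.vert d₀ → ∃ t < s.card, (M.rot ^ t) d₀ = d := fun d hd =>
    hcyc.exists_pow_eq hd₀ (by simpa [hs] using hd)
  have hinj : ∀ t < s.card, ∀ t' < s.card, (M.rot ^ t) d₀ = (M.rot ^ t') d₀ → t = t' := by
    intro t ht t' ht' h
    rw [hcyc.pow_apply_eq_pow_apply hd₀] at h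
    exact h.eq_of_lt_of_lt ht ht'
  refine ⟨s.card, hcyc.pow_card_apply hd₀, hsurj, hinj, fun c => ?_⟩
  rw [boundary, ← Finset.sum_filter, ← hs]
  symm
  refine Finset.sum_bij (fun t _ => (M.rot ^ t) d₀) ?_ ?_ ?_ fun _ _ => rfl
  · intro t _
    simp [hs, vert_rot_pow]
  · intro t ht t' ht' h
    exact hinj t (Finset.mem_range.1 ht) t' (Finset.mem_range.1 ht') h
  · intro d hd
    obtain ⟨t, ht, h⟩ := hsurj d (by simpa [hs] using hd)
    exact ⟨t, Finset.mem_range.2 ht, h⟩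

/-- A cochain whose sum around every vertex vanishes can be integrated along the rotation. -/
lemma exists_apply_rot_eq {c : D → ZMod 2} (hc : ∀ n, M.boundary c n = 0) :
    ∃ g : D → ZMod 2, ∀ d, g (M.rot d) = g d + c d := by
  rcases isEmpty_or_nonempty D with _ | _
  · exact ⟨c, isEmptyElim⟩
  have hex : ∀ n, (∃ d, M.vert d = n) → ∃ d₀, M.vert d₀ = n ∧ ∃ k : ℕ,
      (M.rot ^ k) d₀ = d₀ ∧ (∀ d, M.vert d = n → ∃ t < k, (M.rot ^ t) d₀ = d) ∧
      (∀ t < k, ∀ t' < k, (M.rot ^ t) d₀ = (M.rot ^ t') d₀ → t = t') ∧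
      ∑ t ∈ Finset.range k, c ((M.rot ^ t) d₀) = 0 := by
    rintro n ⟨d₀, rfl⟩
    obtain ⟨k, h₁, h₂, h₃, h₄⟩ := M.exists_boundary_eq_sum_range d₀
    exact ⟨d₀, rfl, k, h₁, h₂, h₃, (h₄ c).symm.trans (hc _)⟩
  choose! b hb k hk hsurj hinj hsum using hex
  have hex' : ∀ d, ∃ t < k (M.vert d), (M.rot ^ t) (b (M.vert d)) = d := fun d =>
    hsurj _ ⟨d, rfl⟩ d rfl
  -- `τ d` is the position of `d` counted from the base dart `b` of its vertex; `g` is the partial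
  -- sum of `c` up to that position.
  choose τ hτ hτ' using hex'
  refine ⟨fun d => ∑ t ∈ Finset.range (τ d), c ((M.rot ^ t) (b (M.vert d))), fun d => ?_⟩
  have hτr := hτ' (M.rot d)
  have hltr := hτ (M.rot d)
  simp only [M.vert_rot] at hτr hltr ⊢
  have hsucc : (M.rot ^ (τ d + 1)) (b (M.vert d)) = M.rot d := by
    rw [pow_succ', Equiv.Perm.mul_apply, hτ']
  have hsum' : ∑ t ∈ Finset.range (τ d + 1), c ((M.rot ^ t) (b (M.vert d))) =
      ∑ t ∈ Finset.range (τ d), c ((M.rot ^ t) (b (M.vert d))) + c d := by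
    rw [Finset.sum_range_succ, hτ']
  rw [← hsum']
  rcases Nat.lt_or_ge (τ d + 1) (k (M.vert d)) with h | h
  · rw [hinj _ ⟨d, rfl⟩ _ hltr _ h (hτr.trans hsucc.symm)]
  -- After the last dart the position jumps back to 0; the vanishing of the full sum makes the
  -- partial sums close up.
  · have hkd : τ d + 1 = k (M.vert d) := le_antisymm (hτ d) h
    have h0 : τ (M.rot d) = 0 := by
      refine hinj _ ⟨d, rfl⟩ _ hltr _ (by omega) (hτr.trans ?_)
      rw [← hsucc, hkd, hk _ ⟨d, rfl⟩, pow_zero, Equiv.Perm.one_apply]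
    rw [h0, hkd, hsum _ ⟨d, rfl⟩, Finset.sum_range_zero]

lemma boundary_mul_of_const {φ p : D → ZMod 2} {n : N} {a : ZMod 2}
    (h : ∀ d, M.vert d = n → φ d = a) :
    M.boundary (φ * p) n = a * M.boundary p n := by
  simp only [boundary, Finset.mul_sum]
  refine Finset.sum_congr rfl fun d _ => ?_
  split_ifs with hd
  · simp [h d hd]
  · simp

end

/-- Summation by parts for three sequences. -/
lemma sum_range_theta (a₀ a₁ a₂ : ZMod 2) (q₀ q₁ q₂ : ℕ → ZMod 2) (k : ℕ) :
    ∑ t ∈ Finset.range k,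
      ((a₀ + ∑ s ∈ Finset.range t, (q₁ s + q₂ s)) * q₀ t +
        (a₁ + ∑ s ∈ Finset.range t, (q₀ s + q₂ s)) * q₁ t +
        (a₂ + ∑ s ∈ Finset.range t, (q₀ s + q₁ s)) * q₂ t +
        (q₀ t * q₁ t + q₀ t * q₂ t + q₁ t * q₂ t)) =
      a₀ * ∑ t ∈ Finset.range k, q₀ t + a₁ * ∑ t ∈ Finset.range k, q₁ t +
        a₂ * ∑ t ∈ Finset.range k, q₂ t +
      ((∑ t ∈ Finset.range k, q₀ t) * (∑ t ∈ Finset.range k, q₁ t) +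
        (∑ t ∈ Finset.range k, q₀ t) * (∑ t ∈ Finset.range k, q₂ t) +
        (∑ t ∈ Finset.range k, q₁ t) * (∑ t ∈ Finset.range k, q₂ t)) := by
  induction k with
  | zero => simp
  | succ k ih =>
    simp only [Finset.sum_range_succ, Finset.sum_add_distrib] at ih ⊢
    linear_combination ih

variable {D N : Type*} [Fintype D] [DecidableEq N] {M : DartSystem D N}

/-- The contribution of a vertex at which only the three paths of a theta graph meet. -/
lemma boundary_theta {φ q : Fin 3 → D → ZMod 2} (hφ : ∀ d, φ 0 d + φ 1 d + φ 2 d = 0) {n : N}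
    {ε : ZMod 2}
    (h₀ : ∀ d, M.vert d = n → φ 0 (M.rot d) = φ 0 d + (q 1 d + q 2 d))
    (h₁ : ∀ d, M.vert d = n → φ 1 (M.rot d) = φ 1 d + (q 0 d + q 2 d))
    (h₂ : ∀ d, M.vert d = n → φ 2 (M.rot d) = φ 2 d + (q 0 d + q 1 d))
    (hq : ∀ m, M.boundary (q m) n = ε) :
    M.boundary (φ 0 * q 0 + φ 1 * q 1 + φ 2 * q 2 + (q 0 * q 1 + q 0 * q 2 + q 1 * q 2)) n = ε := by
  by_cases hn : ∃ d, M.vert d = n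
  · obtain ⟨d, rfl⟩ := hn
    have key : ∀ (ψ c : D → ZMod 2),
        (∀ e, M.vert e = M.vert d → ψ (M.rot e) = ψ e + c e) → ∀ t : ℕ,
        ψ ((M.rot ^ t) d) = ψ d + ∑ s ∈ Finset.range t, c ((M.rot ^ s) d) := by
      intro ψ c h t
      induction t with
      | zero => simp
      | succ t ih =>
        rw [pow_succ', Equiv.Perm.mul_apply, h _ (M.vert_rot_pow t d), ih,
          Finset.sum_range_succ, add_assoc]
    obtain ⟨k, -, -, -, hk⟩ := M.exists_boundary_eq_sum_range d
    -- In one turn around the vertex each potential collects the values of the other two paths. The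
    -- sum becomes `ε` times the starting values, which add up to zero, plus three times `ε * ε`,
    -- that is, `ε`.
    have := sum_range_theta (φ 0 d) (φ 1 d) (φ 2 d) (fun t => q 0 ((M.rot ^ t) d))
      (fun t => q 1 ((M.rot ^ t) d)) (fun t => q 2 ((M.rot ^ t) d)) k
    rw [← hk, ← hk, ← hk, hq, hq, hq] at this
    rw [hk]
    simp only [Pi.add_apply, Pi.mul_apply]
    rw [Finset.sum_congr rfl fun t _ => by
      rw [key _ (fun d => q 1 d + q 2 d) h₀ t, key _ (fun d => q 0 d + q 2 d) h₁ t,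
        key _ (fun d => q 0 d + q 1 d) h₂ t], this]
    have hε : ε * ε = ε := (by decide : ∀ ε : ZMod 2, ε * ε = ε) ε
    rw [hε]
    have h2 : (2 : ZMod 2) = 0 := rfl
    linear_combination ε * hφ d + ε * h2
  -- At a vertex without darts every boundary is zero, and `hq` forces `ε = 0`.
  · push Not at hn
    have h0 : ∀ c : D → ZMod 2, M.boundary c n = 0 := fun c =>
      boundary_eq_zero fun d hd => absurd hd (hn d)
    rw [h0, ← hq 0, h0]

/-- A planar map contains no nine chains joining two triples of vertices in which chains without a
common end are vertex-disjoint. -/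
theorem no_K33 [Fintype N] (hM : M.SimplyConnected) (l r : Fin 3 → N) (T : Fin 3 → Fin 3 → Set N)
    (p : Fin 3 → Fin 3 → D → ZMod 2) (hinv : ∀ i j d, p i j (M.inv d) = p i j d)
    (hbd : ∀ i j n, M.boundary (p i j) n = (if n = l i then 1 else 0) + (if n = r j then 1 else 0))
    (hsupp : ∀ i j d, p i j d ≠ 0 → M.vert d ∈ T i j)
    (hl : ∀ i j, l i ∈ T i j) (hr : ∀ i j, r j ∈ T i j)
    (hdisj : ∀ i i' j j', i ≠ i' → j ≠ j' → Disjoint (T i j) (T i' j')) : False := by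
  classical
  have hdis : ∀ {i i' j j' n}, i ≠ i' → j ≠ j' → n ∈ T i j → n ∉ T i' j' :=
    fun hi hj h h' => Set.disjoint_left.1 (hdisj _ _ _ _ hi hj) h h'
  have hz : ∀ {i j d n}, M.vert d = n → n ∉ T i j → p i j d = 0 := by
    intro i j d n hd hn
    by_contra h
    exact hn (hd ▸ hsupp i j d h)
  have hprod : ∀ {i i' j j'}, i ≠ i' → j ≠ j' → ∀ d, p i j d * p i' j' d = 0 := by
    intro i i' j j' hi hj d
    by_contra h
    exact hdis hi hj (hsupp i j d (left_ne_zero_of_mul h)) (hsupp i' j' d (right_ne_zero_of_mul h))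
  have h2 : (2 : ZMod 2) = 0 := rfl
  -- the cycles of the theta graph spanned by two vertices on the left
  let c : Fin 3 → D → ZMod 2 := ![p 0 1 + p 1 1 + (p 0 2 + p 1 2), p 0 0 + p 1 0 + (p 0 2 + p 1 2),
    p 0 0 + p 1 0 + (p 0 1 + p 1 1)]
  obtain ⟨φ₀, hφ₀, hφ₀'⟩ := hM (c 0) (fun d => by simp [c, hinv]) (fun n => by
    simp only [c, Matrix.cons_val_zero, boundary_add, hbd]
    linear_combination ((if n = l 0 then 1 else 0) + (if n = l 1 then 1 else 0) +
      (if n = r 1 then 1 else 0) + (if n = r 2 then 1 else 0) : ZMod 2) * h2)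
  obtain ⟨φ₁, hφ₁, hφ₁'⟩ := hM (c 1) (fun d => by simp [c, hinv]) (fun n => by
    simp only [c, Matrix.cons_val_one, Matrix.cons_val_zero, boundary_add, hbd]
    linear_combination ((if n = l 0 then 1 else 0) + (if n = l 1 then 1 else 0) +
      (if n = r 0 then 1 else 0) + (if n = r 2 then 1 else 0) : ZMod 2) * h2)
  -- Modulo 2, `c 2 = c 0 + c 1`, so the third potential can be the sum of the other two. This makes
  -- the three add up to zero everywhere.
  let φ : Fin 3 → D → ZMod 2 := ![φ₀, φ₁, φ₀ + φ₁]
  have hsum : ∀ d, φ 0 d + φ 1 d + φ 2 d = 0 := fun d => by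
    simp only [φ, Matrix.cons_val_zero, Matrix.cons_val_one, Matrix.cons_val, Pi.add_apply]
    linear_combination (φ₀ d + φ₁ d) * h2
  have hφ : ∀ m d, φ m d + φ m (M.inv d) = c m d := by
    intro m d
    fin_cases m
    · exact hφ₀' d
    · exact hφ₁' d
    · have e₀ := hφ₀' d
      have e₁ := hφ₁' d
      simp [φ, c] at e₀ e₁ ⊢
      linear_combination e₀ + e₁ + (p 0 2 d + p 1 2 d) * h2
  have hrot : ∀ m d, φ m (M.rot d) = φ m d + c m d := by
    intro m
    refine potential_rot (fun d => ?_) (hφ m)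
    fin_cases m
    · exact hφ₀ d
    · exact hφ₁ d
    · simp [φ, hφ₀, hφ₁]
  have hc : ∀ m d, (∀ m', m' ≠ m → p 0 m' d = 0 ∧ p 1 m' d = 0) → c m d = 0 := by
    intro m d h
    fin_cases m
    · simp [c, h 1 (by decide), h 2 (by decide)]
    · simp [c, h 0 (by decide), h 2 (by decide)]
    · simp [c, h 0 (by decide), h 1 (by decide)]
  -- the value of a potential around a vertex where it is constant
  let Φ : Fin 3 → N → ZMod 2 := fun m n => if h : ∃ d, M.vert d = n then φ m h.choose else 0
  have hΦ : ∀ m n, (∀ d, M.vert d = n → c m d = 0) → ∀ d, M.vert d = n → φ m d = Φ m n := by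
    intro m n h d hd
    have hn : ∃ d, M.vert d = n := ⟨d, hd⟩
    simp only [Φ, dif_pos hn]
    exact potential_const (hrot m) h hd hn.choose_spec
  have hΦsum : ∀ n, Φ 0 n + Φ 1 n + Φ 2 n = 0 := by
    intro n
    by_cases hn : ∃ d, M.vert d = n
    · simp only [Φ, dif_pos hn, hsum]
    · simp only [Φ, dif_neg hn, add_zero]
  -- The paths from `l 0` and `l 2` to `r m` are weighted by the potential `φ m`. The total over all
  -- darts is 0 when computed edge by edge and 1 when computed vertex by vertex. The products in `A`
  -- correct for overlaps among the three paths from `l 0`.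
  let A : D → ZMod 2 := φ 0 * p 0 0 + φ 1 * p 0 1 + φ 2 * p 0 2 +
    (p 0 0 * p 0 1 + p 0 0 * p 0 2 + p 0 1 * p 0 2)
  let B : Fin 3 → D → ZMod 2 := fun m => φ m * p 2 m
  -- `c m` consists of chains from `l 0` and `l 1` ending at some `r m'` with `m' ≠ m`. They are
  -- disjoint from `T 2 m`, so `φ m` is constant around each vertex there.
  have hB : ∀ m n, M.boundary (B m) n =
      (if n = l 2 then Φ m (l 2) else 0) + (if n = r m then Φ m (r m) else 0) := by
    intro m n
    by_cases hn : n ∈ T 2 m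
    · rw [boundary_mul_of_const (hΦ m n fun d hd => hc m d fun m' hm' =>
        ⟨hz hd (hdis (by decide) hm'.symm hn), hz hd (hdis (by decide) hm'.symm hn)⟩), hbd, mul_add]
      congr 1 <;> split_ifs with h <;> simp [h]
    · rw [if_neg fun h : n = l 2 => hn (h ▸ hl 2 m), if_neg fun h : n = r m => hn (h ▸ hr 2 m),
        add_zero]
      exact boundary_eq_zero fun d hd => by simp [B, hz hd hn]
  have hA : ∀ n, M.boundary A n = (if n = l 0 then 1 else 0) +
      ∑ m, if n = r m then Φ m (r m) else 0 := by
    intro n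
    -- If `n` is on at least two of the sets `T 0 m`, it is on no `T 1 m`, so only the three chains
    -- from `l 0` matter and `boundary_theta` applies. Otherwise at most one of these three is
    -- nonzero at `n`, and its potential is constant there.
    by_cases hn : ∀ m, ∃ m', m' ≠ m ∧ n ∈ T 0 m'
    · have h1 : ∀ m d, M.vert d = n → p 1 m d = 0 := by
        intro m d hd
        obtain ⟨m', hm', h⟩ := hn m
        exact hz hd (hdis (by decide) hm' h)
      have hne : ∀ m, n ≠ r m := by
        rintro m rfl
        obtain ⟨m', hm', h⟩ := hn m
        exact hdis (i' := 1) (by decide) hm' h (hr 1 m)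
      simp only [if_neg (hne _), Finset.sum_const_zero, add_zero]
      refine boundary_theta hsum ?_ ?_ ?_ fun m => ?_
      · intro d hd
        rw [hrot]
        simp [c, h1 _ d hd]
      · intro d hd
        rw [hrot]
        simp [c, h1 _ d hd]
      · intro d hd
        rw [hrot]
        simp [c, h1 _ d hd]
      · rw [hbd, if_neg (hne m), add_zero]
    · push Not at hn
      obtain ⟨m, hm⟩ := hn
      have hr' : ∀ m', m' ≠ m → n ≠ r m' := fun m' hm' h => hm m' hm' (h ▸ hr 0 m')
      have hl' : n ≠ l 0 := by
        obtain ⟨m', hm'⟩ := exists_ne m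
        exact fun h => hm m' hm' (h ▸ hl 0 m')
      have hA' : M.boundary A n = M.boundary (φ m * p 0 m) n := by
        refine boundary_congr fun d hd => ?_
        have h0 : ∀ m', m' ≠ m → p 0 m' d = 0 := fun m' hm' => hz hd (hm m' hm')
        fin_cases m
        · simp [A, h0 1 (by decide), h0 2 (by decide)]
        · simp [A, h0 0 (by decide), h0 2 (by decide)]
        · simp [A, h0 0 (by decide), h0 1 (by decide)]
      rw [hA', if_neg hl', zero_add, Finset.sum_eq_single m
        (fun m' _ hm' => if_neg (hr' m' hm')) (by simp)]
      by_cases hnm : n ∈ T 0 m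
      · rw [boundary_mul_of_const (hΦ m n fun d hd => hc m d fun m' hm' =>
          ⟨hz hd (hm m' hm'), hz hd (hdis (by decide) hm'.symm hnm)⟩), hbd, if_neg hl', zero_add]
        split_ifs with h <;> simp [h]
      · rw [if_neg fun h : n = r m => hnm (h ▸ hr 0 m)]
        exact boundary_eq_zero fun d hd => by simp [hz hd hnm]
  have htot : ∑ d, (A d + ∑ m, B m d) = 0 := by
    refine sum_eq_zero_of_pair (M := M) fun d => ?_
    have h01 : ∀ j j', j ≠ j' → p 0 j d * p 1 j' d = 0 := fun j j' h => hprod (by decide) h d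
    have h21 : ∀ j j', j ≠ j' → p 2 j d * p 1 j' d = 0 := fun j j' h => hprod (by decide) h d
    have h20 : ∀ j j', j ≠ j' → p 2 j d * p 0 j' d = 0 := fun j j' h => hprod (by decide) h d
    -- The two potentials on an edge add up to `c m`, and the correction terms double and vanish. Of
    -- the remaining products, those of two chains from `l 0` occur twice, and the others involve
    -- chains without a common end.
    have e : A d + ∑ m, B m d + (A (M.inv d) + ∑ m, B m (M.inv d)) =
        c 0 d * (p 0 0 d + p 2 0 d) + c 1 d * (p 0 1 d + p 2 1 d) + c 2 d * (p 0 2 d + p 2 2 d) := by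
      simp only [A, B, Fin.sum_univ_three, Pi.add_apply, Pi.mul_apply, hinv, ← hφ]
      linear_combination (p 0 0 d * p 0 1 d + p 0 0 d * p 0 2 d + p 0 1 d * p 0 2 d) * h2
    rw [e]
    simp only [c, Matrix.cons_val_zero, Matrix.cons_val_one, Matrix.cons_val, Pi.add_apply]
    linear_combination (p 0 0 d * p 0 1 d + p 0 0 d * p 0 2 d + p 0 1 d * p 0 2 d) * h2 +
      h01 0 1 (by decide) +
      h01 0 2 (by decide) +
      h01 1 0 (by decide) +
      h01 1 2 (by decide) +
      h01 2 0 (by decide) +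
      h01 2 1 (by decide) +
      h21 0 1 (by decide) +
      h21 0 2 (by decide) +
      h21 1 0 (by decide) +
      h21 1 2 (by decide) +
      h21 2 0 (by decide) +
      h21 2 1 (by decide) +
      h20 0 1 (by decide) +
      h20 0 2 (by decide) +
      h20 1 0 (by decide) +
      h20 1 2 (by decide) +
      h20 2 0 (by decide) +
      h20 2 1 (by decide)
  rw [Finset.sum_add_distrib, Finset.sum_comm, ← sum_boundary (M := M)] at htot
  simp only [← sum_boundary (M := M), hA, hB, Finset.sum_add_distrib] at htot
  rw [Finset.sum_comm (f := fun n m => if n = r m then Φ m (r m) else 0)] at htot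
  simp only [Finset.sum_ite_eq', Finset.mem_univ, if_true, Fin.sum_univ_three] at htot
  -- The vertex `l 0` contributes 1, each `Φ m (r m)` occurs once from `A` and once from `B`, and
  -- the values at `l 2` add up to zero.
  have h1 : (1 : ZMod 2) = 0 := by
    linear_combination htot - hΦsum (l 2) - (Φ 0 (r 0) + Φ 1 (r 1) + Φ 2 (r 2)) * h2
  exact one_ne_zero h1

end DartSystem

/-! ### Euler's formula implies that every mod 2 cycle bounds. -/

open Module

/-- A rotation system as a combinatorial map. -/
def RotationSystem.toDartSystem {V : Type u} {G : SimpleGraph V} (R : RotationSystem G) :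
    DartSystem G.Dart V where
  vert d := d.fst
  inv := SimpleGraph.Dart.symm
  rot := R.next
  inv_inv := SimpleGraph.Dart.symm_symm
  inv_ne := SimpleGraph.Dart.symm_ne
  vert_rot := R.fst_next
  sameCycle := R.sameCycle

/-- A function constant along edges of a connected graph is constant. -/
lemma eq_of_forall_adj {V : Type*} {α : Type*} {G : SimpleGraph V} (hG : G.Connected) {f : V → α}
    (h : ∀ x y, G.Adj x y → f x = f y) (x y : V) : f x = f y := by
  obtain ⟨p⟩ := hG.preconnected x y
  induction p with
  | nil => rfl
  | cons hxy _ ih => exact (h _ _ hxy).trans ih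

namespace RotationSystem

variable {V : Type u} {G : SimpleGraph V} (R : RotationSystem G)

/-- The faces. -/
abbrev Face : Type u := Quotient (Equiv.Perm.SameCycle.setoid R.faceNext)

/-- The face on the side of a dart. -/
abbrev face (d : G.Dart) : R.Face := Quotient.mk _ d

lemma face_eq_iff {d d' : G.Dart} : R.face d = R.face d' ↔ R.faceNext.SameCycle d d' :=
  Quotient.eq (r := Equiv.Perm.SameCycle.setoid R.faceNext)

lemma face_faceNext (d : G.Dart) : R.face (R.faceNext d) = R.face d :=
  R.face_eq_iff.2 (Equiv.Perm.sameCycle_apply_left.2 (Equiv.Perm.SameCycle.refl _ _))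

lemma faceNext_symm (d : G.Dart) : R.faceNext d.symm = R.next d := by
  simp [faceNext, flip]

lemma face_next (d : G.Dart) : R.face (R.next d) = R.face d.symm := by
  rw [← faceNext_symm, face_faceNext]

/-- The difference of a function on faces across a dart. -/
def coboundaryDart : (R.Face → ZMod 2) →ₗ[ZMod 2] (G.Dart → ZMod 2) where
  toFun φ d := φ (R.face d) + φ (R.face d.symm)
  map_add' φ ψ := by ext d; simp only [Pi.add_apply]; ring
  map_smul' a φ := by ext d; simp only [Pi.smul_apply, smul_eq_mul, RingHom.id_apply]; ring

end RotationSystem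

section Chains

variable {V : Type u} (G : SimpleGraph V)

lemma exists_dart_edge (e : G.edgeSet) : ∃ d : G.Dart, d.edge = e := by
  obtain ⟨e, he⟩ := e
  induction e with
  | h x y => exact ⟨⟨(x, y), he⟩, rfl⟩

/-- A dart on an edge. -/
noncomputable def edgeDart (e : G.edgeSet) : G.Dart := (exists_dart_edge G e).choose

lemma edge_edgeDart (e : G.edgeSet) : (edgeDart G e).edge = e := (exists_dart_edge G e).choose_spec

lemma edgeDart_edge (d : G.Dart) :
    edgeDart G ⟨d.edge, d.edge_mem⟩ = d ∨ edgeDart G ⟨d.edge, d.edge_mem⟩ = d.symm :=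
  (SimpleGraph.dart_edge_eq_iff _ _).1 (edge_edgeDart G _)

/-- The coboundary of a function on faces as a chain of edges. -/
noncomputable def RotationSystem.coboundary {G : SimpleGraph V} (R : RotationSystem G) :
    (R.Face → ZMod 2) →ₗ[ZMod 2] (G.edgeSet → ZMod 2) where
  toFun φ e := R.coboundaryDart φ (edgeDart G e)
  map_add' φ ψ := by ext e; simp
  map_smul' a φ := by ext e; simp

lemma RotationSystem.coboundary_edge {G : SimpleGraph V} (R : RotationSystem G)
    (φ : R.Face → ZMod 2) (d : G.Dart) :
    R.coboundary φ ⟨d.edge, d.edge_mem⟩ = φ (R.face d) + φ (R.face d.symm) := by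
  change R.coboundaryDart φ (edgeDart G _) = _
  rcases edgeDart_edge G d with h | h <;> rw [h]
  · rfl
  · simp [RotationSystem.coboundaryDart, add_comm]

variable [Fintype G.Dart] [DecidableEq V]

/-- The boundary of a chain of edges. -/
def edgeBoundary : (G.edgeSet → ZMod 2) →ₗ[ZMod 2] (V → ZMod 2) where
  toFun c v := ∑ d : G.Dart, if d.fst = v then c ⟨d.edge, d.edge_mem⟩ else 0
  map_add' c c' := by
    ext v
    simp only [Pi.add_apply, ← Finset.sum_add_distrib]
    refine Finset.sum_congr rfl fun d _ => ?_
    split_ifs <;> simp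
  map_smul' a c := by
    ext v
    simp only [Pi.smul_apply, smul_eq_mul, RingHom.id_apply, Finset.mul_sum, mul_ite, mul_zero]

variable {G}

lemma single_add_single_mem_range {x y : V} (h : G.Adj x y) :
    Pi.single x 1 + Pi.single y 1 ∈ LinearMap.range (edgeBoundary G) := by
  let d₀ : G.Dart := ⟨(x, y), h⟩
  refine ⟨Pi.single ⟨d₀.edge, d₀.edge_mem⟩ 1, ?_⟩
  ext v
  change ∑ d : G.Dart, _ = _
  have hne : d₀ ≠ d₀.symm := d₀.symm_ne.symm
  rw [← Finset.sum_subset (Finset.subset_univ {d₀, d₀.symm}), Finset.sum_pair hne]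
  · simp only [SimpleGraph.Dart.edge_symm, Pi.single_eq_same]
    simp only [d₀, SimpleGraph.Dart.symm, Prod.swap, Pi.add_apply, Pi.single_apply]
    congr 1 <;> exact if_congr eq_comm rfl rfl
  · intro d _ hd
    have : d.edge ≠ d₀.edge := fun h' => hd (by
      rw [SimpleGraph.dart_edge_eq_iff] at h'
      simpa using h')
    rw [Pi.single_eq_of_ne (by simpa [Subtype.ext_iff] using this), ite_self]

/-- A walk from `x` to `y` has boundary `x + y`, and such sums with `y = v₀` fixed span the vectors
of total zero. -/
lemma le_range_edgeBoundary [Fintype V] (hG : G.Connected) :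
    LinearMap.ker (∑ v : V, LinearMap.proj v : (V → ZMod 2) →ₗ[ZMod 2] ZMod 2) ≤
      LinearMap.range (edgeBoundary G) := by
  intro f hf
  obtain ⟨v₀⟩ := hG.nonempty
  have hself : ∀ g : V → ZMod 2, g + g = 0 := fun g => funext fun v => CharTwo.add_self_eq_zero _
  have key : ∀ x y, (Pi.single x 1 + Pi.single y 1 : V → ZMod 2) ∈
      LinearMap.range (edgeBoundary G) := by
    intro x y
    obtain ⟨p⟩ := hG.preconnected x y
    induction p with
    | nil => rw [hself]; exact Submodule.zero_mem _
    | @cons x z y h _ ih =>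
      have := Submodule.add_mem _ (single_add_single_mem_range h) ih
      rwa [add_assoc, ← add_assoc (Pi.single z 1), hself, zero_add] at this
  have hf' : ∑ v, f v = 0 := by simpa [LinearMap.sum_apply] using hf
  have : f = ∑ v, f v • (Pi.single v 1 + Pi.single v₀ 1 : V → ZMod 2) := by
    simp only [smul_add, Finset.sum_add_distrib, ← Finset.sum_smul, hf', zero_smul, add_zero]
    ext w
    simp [Finset.sum_apply, Pi.single_apply]
  rw [this]
  exact Submodule.sum_mem _ fun v _ => Submodule.smul_mem _ _ (key v v₀)

/-- The value on a face does not change across an edge. It is then constant around each vertex, and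
the resulting function on vertices is constant along edges, so connectedness applies. -/
lemma RotationSystem.eq_of_coboundary_eq_zero (R : RotationSystem G) (hG : G.Connected)
    {φ : R.Face → ZMod 2} (h : R.coboundary φ = 0) (a b : R.Face) : φ a = φ b := by
  have hs : ∀ d, φ (R.face d) = φ (R.face d.symm) := fun d => by
    have := R.coboundary_edge φ d
    rw [h] at this
    exact CharTwo.add_eq_zero.1 this.symm
  have hv : ∀ d d' : G.Dart, d.fst = d'.fst → φ (R.face d) = φ (R.face d') := by
    intro d d' hd
    obtain ⟨t, rfl⟩ := (R.sameCycle d d' hd).exists_nat_pow_eq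
    clear hd
    induction t with
    | zero => rfl
    | succ t ih => rw [pow_succ', Equiv.Perm.mul_apply, R.face_next, ← hs, ih]
  let f : V → ZMod 2 := fun v => by
    classical exact if hd : ∃ d : G.Dart, d.fst = v then φ (R.face hd.choose) else 0
  have hf : ∀ d : G.Dart, f d.fst = φ (R.face d) := fun d => by
    have hd : ∃ d' : G.Dart, d'.fst = d.fst := ⟨d, rfl⟩
    simp only [f, dif_pos hd]
    exact hv _ _ hd.choose_spec
  have hadj : ∀ x y, G.Adj x y → f x = f y := fun x y hxy => by
    have h₁ := hf ⟨(x, y), hxy⟩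
    have h₂ := hf ⟨(y, x), hxy.symm⟩
    exact h₁.trans ((hs _).trans h₂.symm)
  induction a using Quotient.inductionOn with
  | h d =>
    induction b using Quotient.inductionOn with
    | h d' => exact (hf d).symm.trans ((eq_of_forall_adj hG hadj _ _).trans (hf d'))

/-- The faces on the two sides of a dart `d` are those of `d` and `next d`. Since `next` permutes
the darts at a vertex, each face value is counted twice there. -/
lemma RotationSystem.edgeBoundary_coboundary (R : RotationSystem G) (φ : R.Face → ZMod 2) :
    edgeBoundary G (R.coboundary φ) = 0 := by
  ext v
  change ∑ d : G.Dart, (if d.fst = v then R.coboundary φ ⟨d.edge, d.edge_mem⟩ else 0) = 0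
  simp only [R.coboundary_edge, ← R.face_next]
  have : ∑ d : G.Dart, (if d.fst = v then φ (R.face (R.next d)) else 0) =
      ∑ d : G.Dart, (if d.fst = v then φ (R.face d) else 0) := by
    rw [← Equiv.sum_comp R.next fun d => if d.fst = v then φ (R.face d) else 0]
    simp only [R.fst_next]
  calc _ = ∑ d : G.Dart, (if d.fst = v then φ (R.face d) else 0) +
        ∑ d : G.Dart, (if d.fst = v then φ (R.face (R.next d)) else 0) := by
        rw [← Finset.sum_add_distrib]
        refine Finset.sum_congr rfl fun d _ => ?_
        split_ifs <;> simp
    _ = 0 := by rw [this, CharTwo.add_self_eq_zero]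

/-- Euler's formula implies that every cycle bounds. -/
theorem RotationSystem.simplyConnected_of_euler [Finite V] (R : RotationSystem G)
    (hG : G.Connected) (h : Nat.card V + R.numFaces = Nat.card G.edgeSet + 2) :
    R.toDartSystem.SimplyConnected := by
  classical
  have := Fintype.ofFinite V
  have : Finite R.Face := Quotient.finite _
  have := Fintype.ofFinite R.Face
  have := Fintype.ofFinite G.edgeSet
  have hF : Fintype.card R.Face = R.numFaces := (Nat.card_eq_fintype_card).symm
  rw [← hF, Nat.card_eq_fintype_card, Nat.card_eq_fintype_card] at h
  have h₁ := LinearMap.finrank_range_add_finrank_ker (edgeBoundary G)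
  have h₂ := LinearMap.finrank_range_add_finrank_ker R.coboundary
  have h₃ := LinearMap.finrank_range_add_finrank_ker
    (∑ v : V, LinearMap.proj v : (V → ZMod 2) →ₗ[ZMod 2] ZMod 2)
  have h₄ := Submodule.finrank_mono (le_range_edgeBoundary hG)
  have h₅ := Submodule.finrank_le (LinearMap.range
    (∑ v : V, LinearMap.proj v : (V → ZMod 2) →ₗ[ZMod 2] ZMod 2))
  have h₆ : finrank (ZMod 2) (LinearMap.ker R.coboundary) ≤ 1 := by
    have hle : LinearMap.ker R.coboundary ≤ Submodule.span (ZMod 2) {fun _ => 1} := by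
      intro φ hφ
      rw [Submodule.mem_span_singleton]
      by_cases hne : Nonempty R.Face
      · obtain ⟨a⟩ := hne
        exact ⟨φ a, funext fun b => by simpa using R.eq_of_coboundary_eq_zero hG hφ a b⟩
      · exact ⟨0, funext fun b => absurd ⟨b⟩ hne⟩
    exact (Submodule.finrank_mono hle).trans ((finrank_span_le_card _).trans (by simp))
  simp only [finrank_fintype_fun_eq_card, finrank_self] at h₁ h₂ h₃ h₅
  have hle : LinearMap.range R.coboundary ≤ LinearMap.ker (edgeBoundary G) := by
    rintro _ ⟨φ, rfl⟩
    exact R.edgeBoundary_coboundary φ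
  -- The boundary has rank at least |V| - 1, so cycles have dimension at most |E| - |V| + 1. The
  -- coboundary has kernel of dimension at most 1, so rank at least |F| - 1. Euler's formula makes
  -- the two numbers equal.
  have heq := Submodule.eq_of_le_of_finrank_le hle (by omega)
  intro c hc hbd
  have hmem : (fun e => c (edgeDart G e)) ∈ LinearMap.range R.coboundary := by
    rw [heq]
    refine funext fun v => (Finset.sum_congr rfl fun d _ => ?_).trans (hbd v)
    change (if d.fst = v then c (edgeDart G ⟨d.edge, d.edge_mem⟩) else 0) = if d.fst = v then _ else _
    rcases edgeDart_edge G d with h | h <;> rw [h]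
    exact congrArg (fun a => if d.fst = v then a else 0) (hc d)
  obtain ⟨φ, hφ⟩ := hmem
  refine ⟨fun d => φ (R.face d), fun d => congrArg φ ?_, fun d => ?_⟩
  · have := R.face_next d.symm
    rwa [SimpleGraph.Dart.symm_symm] at this
  · refine (R.coboundary_edge φ d).symm.trans ?_
    rw [hφ]
    change c (edgeDart G ⟨d.edge, d.edge_mem⟩) = c d
    rcases edgeDart_edge G d with h | h <;> rw [h]
    exact hc d

end Chains

/-- In a planar embedding every cycle bounds. -/
theorem PlanarEmbedding.simplyConnected {V : Type u} [Finite V] {J : VGraph V}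
    [Fintype J.coe.Dart] [DecidableEq J.verts] (M : PlanarEmbedding J) :
    M.toDartSystem.SimplyConnected := by
  refine M.simplyConnected_of_euler M.connected.coe ?_
  have h := M.euler
  rw [← SimpleGraph.Subgraph.image_coe_edgeSet_coe,
    Set.ncard_image_of_injective _ (Sym2.map.injective Subtype.val_injective)] at h
  exact h

/-! ### Adding a vertex in every face. -/

namespace RotationSystem

variable {V : Type u} {G : SimpleGraph V} (R : RotationSystem G)

/-- The combinatorial map of the faces. -/
def dual : DartSystem G.Dart R.Face where
  vert := R.face
  inv := SimpleGraph.Dart.symm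
  rot := R.faceNext
  inv_inv := SimpleGraph.Dart.symm_symm
  inv_ne := SimpleGraph.Dart.symm_ne
  vert_rot := R.face_faceNext
  sameCycle _ _ h := R.face_eq_iff.1 h

/-- The rotation after a vertex is added in every face. -/
def starredRot : Equiv.Perm (G.Dart ⊕ (G.Dart ⊕ G.Dart)) where
  -- The spoke indexed by `d` leaves `d.fst` immediately before `d`. The new faces are triangles,
  -- one for each old dart `d`: `d`, the spoke inwards at `faceNext d`, and the spoke outwards at
  -- `d`.
  toFun := Sum.elim (fun d => Sum.inr (Sum.inl (R.next d)))
      (Sum.elim (fun d => Sum.inl d) (fun d => Sum.inr (Sum.inr (R.faceNext.symm d))))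
  invFun := Sum.elim (fun d => Sum.inr (Sum.inl d))
      (Sum.elim (fun d => Sum.inl (R.next.symm d)) (fun d => Sum.inr (Sum.inr (R.faceNext d))))
  left_inv := by rintro (d | d | d) <;> simp
  right_inv := by rintro (d | d | d) <;> simp

/-- The map obtained by adding a vertex in every face and joining it to all corners of the face.
The darts are those of the original map, the spokes directed towards the new vertices, and the
spokes directed away from them. -/
def starred [Finite G.Dart] : DartSystem (G.Dart ⊕ (G.Dart ⊕ G.Dart)) (V ⊕ R.Face) where
  vert := Sum.elim (fun d => Sum.inl d.fst)
    (Sum.elim (fun d => Sum.inl d.fst) (fun d => Sum.inr (R.face d)))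
  inv := Sum.map SimpleGraph.Dart.symm Sum.swap
  rot := R.starredRot
  inv_inv := by rintro (d | d | d) <;> simp
  inv_ne := by rintro (d | d | d) <;> simp [SimpleGraph.Dart.symm_ne]
  vert_rot := by
    rintro (d | d | d)
    · simp [starredRot, R.fst_next]
    · simp [starredRot]
    · have := R.face_faceNext (R.faceNext.symm d)
      rw [Equiv.apply_symm_apply] at this
      exact congrArg Sum.inr this.symm
  sameCycle := by
    set σ := R.starredRot
    have hbase : ∀ d, σ (Sum.inl d) = Sum.inr (Sum.inl (R.next d)) := fun d => rfl
    have hout : ∀ d, σ (Sum.inr (Sum.inl d)) = Sum.inl d := fun d => rfl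
    have hinn : ∀ d, σ (Sum.inr (Sum.inr d)) = Sum.inr (Sum.inr (R.faceNext.symm d)) := fun d => rfl
    have ho : ∀ d, σ.SameCycle (Sum.inr (Sum.inl d)) (Sum.inl d) := fun d => by
      rw [← hout d]
      exact Equiv.Perm.sameCycle_apply_right.2 (Equiv.Perm.SameCycle.refl _ _)
    have hb : ∀ d d' : G.Dart, d.fst = d'.fst → σ.SameCycle (Sum.inl d) (Sum.inl d') := by
      intro d d' h
      obtain ⟨t, rfl⟩ := (R.sameCycle d d' h).exists_nat_pow_eq
      clear h
      induction t with
      | zero => exact Equiv.Perm.SameCycle.refl _ _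
      | succ t ih =>
        rw [pow_succ', Equiv.Perm.mul_apply]
        refine ih.trans (Equiv.Perm.SameCycle.trans ?_ (ho _))
        rw [← hbase]
        exact Equiv.Perm.sameCycle_apply_right.2 (Equiv.Perm.SameCycle.refl _ _)
    rintro (d | d | d) (d' | d' | d') h <;>
      simp only [Sum.elim_inl, Sum.elim_inr, Sum.inl.injEq, Sum.inr.injEq, reduceCtorEq] at h
    · exact hb d d' h
    · exact (hb d d' h).trans (ho d').symm
    · exact (ho d).trans (hb d d' h)
    · exact (ho d).trans ((hb d d' h).trans (ho d').symm)
    · obtain ⟨t, ht⟩ := (R.face_eq_iff.1 h).symm.exists_nat_pow_eq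
      subst ht
      clear h
      refine Equiv.Perm.SameCycle.symm ?_
      induction t with
      | zero => exact Equiv.Perm.SameCycle.refl _ _
      | succ t ih =>
        refine ih.trans (Equiv.Perm.SameCycle.symm ?_)
        have := hinn ((R.faceNext ^ (t + 1)) d')
        rw [pow_succ', Equiv.Perm.mul_apply, Equiv.symm_apply_apply] at this
        rw [pow_succ', Equiv.Perm.mul_apply, ← this]
        exact Equiv.Perm.sameCycle_apply_right.2 (Equiv.Perm.SameCycle.refl _ _)

variable [Fintype G.Dart] [DecidableEq V] [DecidableEq R.Face] {R}

lemma starred_boundary_inl (c : G.Dart ⊕ (G.Dart ⊕ G.Dart) → ZMod 2) (v : V) :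
    R.starred.boundary c (Sum.inl v) =
      R.toDartSystem.boundary (fun d => c (Sum.inl d)) v +
        R.toDartSystem.boundary (fun d => c (Sum.inr (Sum.inl d))) v := by
  simp only [DartSystem.boundary, starred, toDartSystem, Fintype.sum_sum_type, Sum.elim_inl,
    Sum.elim_inr, Sum.inl.injEq, reduceCtorEq, if_false, Finset.sum_const_zero, add_zero]
  congr 1

lemma starred_boundary_inr (c : G.Dart ⊕ (G.Dart ⊕ G.Dart) → ZMod 2) (a : R.Face) :
    R.starred.boundary c (Sum.inr a) =
      R.dual.boundary (fun d => c (Sum.inr (Sum.inr d))) a := by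
  simp only [DartSystem.boundary, starred, dual, Fintype.sum_sum_type, Sum.elim_inl,
    Sum.elim_inr, Sum.inr.injEq, reduceCtorEq, if_false, Finset.sum_const_zero, zero_add]
  exact Finset.sum_congr rfl fun d _ => if_congr Iff.rfl rfl rfl

/-- Adding a vertex in every face preserves planarity. -/
theorem SimplyConnected.starred (h : R.toDartSystem.SimplyConnected) :
    R.starred.SimplyConnected := by
  intro c hc hbd
  have hshift : ∀ {N : Type u} [DecidableEq N] (M : DartSystem G.Dart N) (g : G.Dart → ZMod 2)
      (n : N), M.boundary (fun d => g (M.rot d)) n = M.boundary g n := by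
    intro N _ M g n
    simp only [DartSystem.boundary]
    rw [← Equiv.sum_comp M.rot fun d => if M.vert d = n then g d else 0]
    simp only [M.vert_rot]
  have hs : ∀ d, c (Sum.inr (Sum.inr d)) = c (Sum.inr (Sum.inl d)) := fun d =>
    hc (Sum.inr (Sum.inl d))
  -- `g` adds up the spoke values along each facial walk. It is well defined because the boundary of
  -- `c` vanishes at the vertex in the face.
  obtain ⟨g, hg⟩ := DartSystem.exists_apply_rot_eq (M := R.dual)
    (c := fun d => c (Sum.inr (Sum.inl (R.faceNext d)))) (fun a => by
      refine (hshift R.dual (fun d => c (Sum.inr (Sum.inl d))) a).trans ?_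
      simp only [← hs]
      rw [← starred_boundary_inr, hbd])
  have hg' : ∀ d, g (R.faceNext d) = g d + c (Sum.inr (Sum.inl (R.faceNext d))) := hg
  have hgs : ∀ d : G.Dart, g d.symm = g (R.next d) + c (Sum.inr (Sum.inl (R.next d))) := fun d => by
    rw [← faceNext_symm, hg', add_assoc, CharTwo.add_self_eq_zero, add_zero]
  -- Adding `g d + g d.symm` pushes the spokes onto the boundaries of the faces. What remains is a
  -- cycle of the original map, so it has a potential `φ`.
  obtain ⟨φ, hφ, hφ'⟩ := h (fun d => c (Sum.inl d) + (g d + g d.symm))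
    (fun d => by
      have : c (Sum.inl d.symm) = c (Sum.inl d) := hc (Sum.inl d)
      change c (Sum.inl d.symm) + (g d.symm + g d.symm.symm) = _
      rw [this, SimpleGraph.Dart.symm_symm, add_comm (g d.symm)])
    (fun v => by
      have h₁ : R.toDartSystem.boundary (fun d : G.Dart => g d.symm) v =
          R.toDartSystem.boundary g v +
            R.toDartSystem.boundary (fun d => c (Sum.inr (Sum.inl d))) v := by
        simp only [hgs]
        rw [← DartSystem.boundary_add]
        exact hshift R.toDartSystem (fun d => g d + c (Sum.inr (Sum.inl d))) v
      have h₂ := hbd (Sum.inl v)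
      rw [starred_boundary_inl] at h₂
      refine (DartSystem.boundary_add (fun d => c (Sum.inl d)) (fun d => g d + g d.symm) v).trans ?_
      rw [show (fun d : G.Dart => g d + g d.symm) = g + fun d => g d.symm from rfl,
        DartSystem.boundary_add, h₁, ← add_assoc (R.toDartSystem.boundary g v),
        CharTwo.add_self_eq_zero, zero_add, h₂])
  have hφf : ∀ d, φ (R.faceNext d) = φ d := fun d => hφ d
  have hψ : ∀ d, φ (R.faceNext.symm d) + g (R.faceNext.symm d) + (φ d + g d) =
      c (Sum.inr (Sum.inl d)) := by
    intro d
    obtain ⟨e, rfl⟩ := R.faceNext.surjective d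
    rw [Equiv.symm_apply_apply, hφf, hg']
    have h2 : (2 : ZMod 2) = 0 := rfl
    linear_combination (φ e + g e) * h2
  -- The triangle of an old dart `d` receives `φ d + g d`. The inward spoke `d` lies on the triangle
  -- of `faceNext.symm d`, the outward spoke `d` on that of `d`.
  refine ⟨Sum.elim (fun d => φ d + g d) (Sum.elim
    (fun d => φ (R.faceNext.symm d) + g (R.faceNext.symm d)) (fun d => φ d + g d)), ?_, ?_⟩
  · rintro (d | d | d)
    · change φ (R.faceNext.symm (R.faceNext d)) + g (R.faceNext.symm (R.faceNext d)) = φ d + g d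
      rw [Equiv.symm_apply_apply]
    · rfl
    · rfl
  · rintro (d | d | d)
    · have := hφ' d
      change φ d + φ d.symm = _ at this
      change φ d + g d + (φ d.symm + g d.symm) = _
      have h2 : (2 : ZMod 2) = 0 := rfl
      linear_combination this + (g d + g d.symm) * h2
    · exact hψ d
    · refine (add_comm _ _).trans ((hψ d).trans (hs d).symm)

end RotationSystem

/-! ### Components and separators -/

section Components

variable {V : Type u} {K : VGraph V} {U U' : Set V}

lemma exists_isComponent {x : V} (hx : x ∈ K.verts) : ∃ U, IsComponent K U ∧ x ∈ U :=
  ⟨_, ⟨K.coe.connectedComponentMk ⟨x, hx⟩, rfl⟩, ⟨x, hx⟩, rfl, rfl⟩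

lemma IsComponent.subset_verts (h : IsComponent K U) : U ⊆ K.verts := by
  obtain ⟨c, rfl⟩ := h
  rintro _ ⟨x, -, rfl⟩
  exact x.2

lemma IsComponent.eq_of_mem (h : IsComponent K U) (h' : IsComponent K U') {x : V} (hx : x ∈ U)
    (hx' : x ∈ U') : U = U' := by
  obtain ⟨c, rfl⟩ := h
  obtain ⟨c', rfl⟩ := h'
  obtain ⟨y, hy, rfl⟩ := hx
  obtain ⟨y', hy', hyy'⟩ := hx'
  obtain rfl := Subtype.ext hyy'
  rw [SimpleGraph.ConnectedComponent.mem_supp_iff] at hy hy'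
  rw [← hy, ← hy']

lemma IsComponent.mem_of_adj (h : IsComponent K U) {x y : V} (hx : x ∈ U) (hxy : K.Adj x y) :
    y ∈ U := by
  obtain ⟨c, rfl⟩ := h
  obtain ⟨x, hx, rfl⟩ := hx
  refine ⟨⟨y, hxy.snd_mem⟩, ?_, rfl⟩
  rw [SimpleGraph.ConnectedComponent.mem_supp_iff] at hx ⊢
  rw [← hx]
  exact SimpleGraph.ConnectedComponent.sound (SimpleGraph.Adj.reachable hxy.symm)

variable {H J : VGraph V} {X : Set V}

lemma exists_attachesAt {x : V} (hx : x ∈ H.verts) (hx' : x ∉ J.verts) :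
    ∃ U X, AttachesAt H J U X ∧ x ∈ U := by
  obtain ⟨U, hU, hxU⟩ := exists_isComponent (K := H.deleteVerts J.verts) (x := x) ⟨hx, hx'⟩
  exact ⟨U, _, ⟨hU, rfl⟩, hxU⟩

lemma AttachesAt.mem_verts (h : AttachesAt H J U X) {x : V} (hx : x ∈ U) : x ∈ H.verts :=
  (h.1.subset_verts hx).1

lemma AttachesAt.notMem (h : AttachesAt H J U X) {x : V} (hx : x ∈ U) : x ∉ J.verts :=
  (h.1.subset_verts hx).2

lemma AttachesAt.subset_verts (h : AttachesAt H J U X) : X ⊆ J.verts := by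
  rintro x hx
  rw [← h.2] at hx
  exact hx.1

lemma AttachesAt.mem_of_adj (h : AttachesAt H J U X) {x y : V} (hx : x ∈ U) (hxy : H.Adj x y)
    (hy : y ∉ J.verts) : y ∈ U :=
  h.1.mem_of_adj hx
    (by simpa [hxy, h.notMem hx, hy, h.mem_verts hx] using hxy.snd_mem)

lemma AttachesAt.mem_separator (h : AttachesAt H J U X) {x y : V} (hx : x ∈ U) (hxy : H.Adj x y)
    (hy : y ∈ J.verts) : y ∈ X := by
  rw [← h.2]
  exact ⟨hy, x, hx, hxy⟩

lemma AttachesAt.eq_of_mem {X' : Set V} (h : AttachesAt H J U X) (h' : AttachesAt H J U' X')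
    {x : V} (hx : x ∈ U) (hx' : x ∈ U') : U = U' ∧ X = X' := by
  obtain rfl := h.1.eq_of_mem h'.1 hx hx'
  exact ⟨rfl, h.2.symm.trans h'.2⟩

lemma AttachesAt.exists_adj (h : AttachesAt H J U X) {x : V} (hx : x ∈ X) : ∃ a ∈ U, H.Adj a x := by
  rw [← h.2] at hx
  exact hx.2

/-- The union of the components that attach at `X`. -/
def interior (H J : VGraph V) (X : Set V) : Set V := ⋃₀ {U | AttachesAt H J U X}

/-- This makes `X` a vertex boundary of the interior; all later counting uses only this and the size
of `X`. -/
lemma interior_boundary {x y : V} (hx : x ∈ interior H J X) (hxy : H.Adj x y) :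
    y ∈ interior H J X ∨ y ∈ X := by
  obtain ⟨U, hU, hxU⟩ := hx
  by_cases hy : y ∈ J.verts
  · exact Or.inr (hU.mem_separator hxU hxy hy)
  · exact Or.inl ⟨U, hU, hU.mem_of_adj hxU hxy hy⟩

lemma interior_disjoint (hX : X ⊆ J.verts) : Disjoint (interior H J X) X := by
  rw [Set.disjoint_left]
  rintro x ⟨U, hU, hxU⟩ hx
  exact hU.notMem hxU (hX hx)

lemma IsReduction.ncard_separator_le {C : Root ↪ V} (hJ : IsReduction H C J)
    (h : AttachesAt H J U X) : X.ncard ≤ 3 := by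
  obtain ⟨x, y, z, rfl, -⟩ := hJ.triangle U X h
  exact (Set.ncard_insert_le _ _).trans
    (Nat.succ_le_succ ((Set.ncard_insert_le _ _).trans (by rw [Set.ncard_singleton])))

end Components

/-! ### Contracting the attached components to the faces -/

section Contraction

namespace DartSystem

variable {D N : Type*} [Fintype D] [DecidableEq N] {M : DartSystem D N}

variable (M) in
/-- Chains of darts between two vertices with given support. -/
def HasChain (S : Set N) (a b : N) : Prop :=
  ∃ c : D → ZMod 2, (∀ d, c (M.inv d) = c d) ∧
    (∀ n, M.boundary c n = (if n = a then 1 else 0) + (if n = b then 1 else 0)) ∧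
    ∀ d, c d ≠ 0 → M.vert d ∈ S

lemma hasChain_refl (S : Set N) (a : N) : M.HasChain S a a :=
  ⟨0, fun _ => rfl, fun n => by
    rw [CharTwo.add_self_eq_zero]
    exact boundary_eq_zero fun _ _ => rfl, fun _ h => absurd rfl h⟩

lemma HasChain.trans {S : Set N} {a b c : N} (h : M.HasChain S a b) (h' : M.HasChain S b c) :
    M.HasChain S a c := by
  obtain ⟨p, hp, hpb, hps⟩ := h
  obtain ⟨q, hq, hqb, hqs⟩ := h'
  refine ⟨p + q, fun d => by simp [hp, hq], fun n => ?_, fun d hd => ?_⟩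
  · rw [boundary_add, hpb, hqb]
    have h2 : (2 : ZMod 2) = 0 := rfl
    linear_combination (if n = b then 1 else 0 : ZMod 2) * h2
  · by_cases hpd : p d = 0
    · exact hqs d fun hqd => hd (by simp [hpd, hqd])
    · exact hps d hpd

lemma hasChain_dart {S : Set N} (d : D) (h : M.vert d ∈ S) (h' : M.vert (M.inv d) ∈ S) :
    M.HasChain S (M.vert d) (M.vert (M.inv d)) := by
  classical
  have hb : ∀ d n, M.boundary (Pi.single d 1) n = if n = M.vert d then 1 else 0 := by
    intro d n
    rw [boundary, Finset.sum_eq_single d]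
    · simp [eq_comm]
    · intro e _ he
      simp [he]
    · simp
  refine ⟨Pi.single d 1 + Pi.single (M.inv d) 1, fun e => ?_, fun n => ?_, fun e he => ?_⟩
  · have h₁ : M.inv e = d ↔ e = M.inv d := ⟨fun h => by rw [← h, M.inv_inv],
      fun h => by rw [h, M.inv_inv]⟩
    have h₂ : M.inv e = M.inv d ↔ e = d := ⟨fun h => by rw [← M.inv_inv e, h, M.inv_inv],
      fun h => by rw [h]⟩
    simp only [Pi.add_apply, Pi.single_apply, h₁, h₂, add_comm]
  · rw [boundary_add, hb, hb]
  · by_cases h₁ : e = d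
    · exact h₁ ▸ h
    · by_cases h₂ : e = M.inv d
      · exact h₂ ▸ h'
      · simp [h₁, h₂] at he

/-- The map `ρ` collapses an edge or sends it to a dart, and the intermediate ends cancel modulo 2.
-/
lemma hasChain_of_walk {W : Type*} {G : SimpleGraph W} {ρ : W → N}
    (hρ : ∀ x y, G.Adj x y →
      ρ x = ρ y ∨ ∃ d, M.vert d = ρ x ∧ M.vert (M.inv d) = ρ y)
    {x y : W} (p : G.Walk x y) (S : Set N) (hS : ∀ z ∈ p.support, ρ z ∈ S) :
    M.HasChain S (ρ x) (ρ y) := by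
  induction p with
  | nil => exact hasChain_refl _ _
  | @cons x z y h p ih =>
    refine HasChain.trans (b := ρ z) ?_ (ih fun w hw => hS w (by simp [hw]))
    have hx : ρ x ∈ S := hS x (by simp)
    have hz : ρ z ∈ S := hS z (by simp)
    rcases hρ x z h with h | ⟨d, hd, hd'⟩
    · rw [h]
      exact hasChain_refl _ _
    · have := hasChain_dart (S := S) d (hd ▸ hx) (hd' ▸ hz)
      rwa [hd, hd'] at this

end DartSystem

variable {W : Type u} {F J : VGraph W}

/-- The vertices of a triangular face are those at its darts. -/
lemma PlanarEmbedding.IsTriangularFace.exists_face {M : PlanarEmbedding J} {X : Set W}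
    (h : M.IsTriangularFace X) :
    ∃ a : M.Face, ∀ x, x ∈ X ↔ ∃ d : J.coe.Dart, M.face d = a ∧ (d.fst : W) = x := by
  obtain ⟨d, hd, rfl⟩ := h
  refine ⟨M.face d, fun x => ⟨?_, ?_⟩⟩
  · rintro (rfl | rfl | rfl)
    · exact ⟨d, rfl, rfl⟩
    · exact ⟨_, M.face_faceNext d, rfl⟩
    · exact ⟨_, (M.face_faceNext _).trans (M.face_faceNext d), rfl⟩
  · rintro ⟨d', hd', rfl⟩
    obtain ⟨t, ht⟩ := (M.face_eq_iff.1 hd').symm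
    have key : ∀ t : ℤ, (M.faceNext ^ t) d = d ∨ (M.faceNext ^ t) d = M.faceNext d ∨
        (M.faceNext ^ t) d = M.faceNext (M.faceNext d) := by
      intro t
      induction t with
      | zero => exact Or.inl rfl
      | succ t ih =>
        rw [add_comm, zpow_add, zpow_one, Equiv.Perm.mul_apply]
        rcases ih with h | h | h <;> rw [h]
        · exact Or.inr (Or.inl rfl)
        · exact Or.inr (Or.inr rfl)
        · exact Or.inl hd
      | pred t ih =>
        rw [sub_eq_add_neg, add_comm, zpow_add, Equiv.Perm.mul_apply, zpow_neg_one]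
        rcases ih with h | h | h <;> rw [h]
        · exact Or.inr (Or.inr (by rw [Equiv.Perm.inv_eq_iff_eq, hd]))
        · exact Or.inl (by simp)
        · exact Or.inr (Or.inl (by simp))
    rw [← ht]
    rcases key t with h | h | h <;> rw [h] <;> simp

/-- Contraction of the components of `F - V(J)` to the faces of `J` at which they attach. -/
lemma exists_contraction {C : Root ↪ W} {M : PlanarEmbedding J} [Finite J.coe.Dart]
    (h : IsStrongPlanarReductionWith F C J M) :
    ∃ ρ : W → J.verts ⊕ M.Face,
      (∀ x y, F.Adj x y → ρ x = ρ y ∨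
        ∃ d, M.starred.vert d = ρ x ∧ M.starred.vert (M.starred.inv d) = ρ y) ∧
      ∀ x y, x ∈ F.verts → y ∈ F.verts → ρ x = ρ y →
        x = y ∨ ∃ X, x ∈ interior F J X ∧ y ∈ interior F J X := by
  classical
  obtain ⟨hJ, hM⟩ := h
  -- One face with vertex set `X` is fixed for each separator, so that all components attaching at
  -- `X` go to the same new vertex. The value `none` is for sets that are not separators.
  have hα : ∀ X, ∃ a : Option M.Face, (∃ U, AttachesAt F J U X) → ∃ b, a = some b ∧
      ∀ x, x ∈ X ↔ ∃ d : J.coe.Dart, M.face d = b ∧ (d.fst : W) = x := by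
    intro X
    by_cases hX : ∃ U, AttachesAt F J U X
    · obtain ⟨U, hU⟩ := hX
      obtain ⟨b, hb⟩ := (hM U X hU).exists_face
      exact ⟨some b, fun _ => ⟨b, rfl, hb⟩⟩
    · exact ⟨none, fun h => absurd h hX⟩
  choose α hα using hα
  have hρ : ∀ x, ∃ n : J.verts ⊕ M.Face, (∀ hx : x ∈ J.verts, n = Sum.inl ⟨x, hx⟩) ∧
      ∀ U X, AttachesAt F J U X → x ∈ U → ∃ b, α X = some b ∧ n = Sum.inr b := by
    intro x
    by_cases hx : x ∈ J.verts
    · exact ⟨Sum.inl ⟨x, hx⟩, fun _ => rfl, fun U X hU hxU => absurd hx (hU.notMem hxU)⟩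
    · by_cases hxF : x ∈ F.verts
      · obtain ⟨U, X, hU, hxU⟩ := exists_attachesAt hxF hx
        obtain ⟨b, hb, -⟩ := hα X ⟨U, hU⟩
        refine ⟨Sum.inr b, fun h => absurd h hx, fun U' X' hU' hxU' => ?_⟩
        obtain ⟨rfl, rfl⟩ := hU.eq_of_mem hU' hxU hxU'
        exact ⟨b, hb, rfl⟩
      -- Vertices outside `F` get an arbitrary image.
      · exact ⟨Sum.inl ⟨C .vstar, hJ.root_mem _⟩, fun h => absurd h hx,
          fun U X hU hxU => absurd (hU.mem_verts hxU) hxF⟩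
  choose ρ hρJ hρU using hρ
  -- an edge between `J` and a component is mapped to a spoke
  have hspoke : ∀ x y, F.Adj x y → x ∈ J.verts → y ∉ J.verts → ∃ d : J.coe.Dart,
      ρ x = Sum.inl d.fst ∧ ρ y = Sum.inr (M.face d) := by
    intro x y hxy hx hy
    obtain ⟨U, X, hU, hyU⟩ := exists_attachesAt hxy.snd_mem hy
    obtain ⟨b, hb, hb'⟩ := hρU y U X hU hyU
    obtain ⟨b', hbb', hX⟩ := hα X ⟨U, hU⟩
    obtain rfl : b = b' := Option.some.inj (hb.symm.trans hbb')
    obtain ⟨d, hd, hdx⟩ := (hX x).1 (hU.mem_separator hyU hxy.symm hx)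
    refine ⟨d, ?_, ?_⟩
    · rw [hρJ x hx]
      exact congrArg Sum.inl (Subtype.ext hdx.symm)
    · rw [hb', hd]
  refine ⟨ρ, fun x y hxy => ?_, fun x y hx hy hxy => ?_⟩
  · by_cases hx : x ∈ J.verts <;> by_cases hy : y ∈ J.verts
    · have hJxy : J.Adj x y := (hJ.adj_iff x y).2 ⟨hx, hy, Or.inl hxy⟩
      refine Or.inr ⟨Sum.inl ⟨(⟨x, hx⟩, ⟨y, hy⟩), hJxy⟩, ?_, ?_⟩
      · exact (hρJ x hx).symm
      · exact (hρJ y hy).symm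
    · obtain ⟨d, h₁, h₂⟩ := hspoke x y hxy hx hy
      exact Or.inr ⟨Sum.inr (Sum.inl d), h₁.symm, h₂.symm⟩
    · obtain ⟨d, h₁, h₂⟩ := hspoke y x hxy.symm hy hx
      exact Or.inr ⟨Sum.inr (Sum.inr d), h₂.symm, h₁.symm⟩
    · obtain ⟨U, X, hU, hxU⟩ := exists_attachesAt hxy.fst_mem hx
      obtain ⟨b, hb, hb'⟩ := hρU x U X hU hxU
      obtain ⟨b', h₁, h₂⟩ := hρU y U X hU (hU.mem_of_adj hxU hxy hy)
      left
      rw [hb', h₂, Option.some.inj (hb.symm.trans h₁)]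
  · by_cases hxJ : x ∈ J.verts <;> by_cases hyJ : y ∈ J.verts
    · rw [hρJ x hxJ, hρJ y hyJ] at hxy
      exact Or.inl (congrArg Subtype.val (Sum.inl.inj hxy))
    · obtain ⟨U, X, hU, hyU⟩ := exists_attachesAt hy hyJ
      obtain ⟨b, -, hb⟩ := hρU y U X hU hyU
      rw [hρJ x hxJ, hb] at hxy
      cases hxy
    · obtain ⟨U, X, hU, hxU⟩ := exists_attachesAt hx hxJ
      obtain ⟨b, -, hb⟩ := hρU x U X hU hxU
      rw [hρJ y hyJ, hb] at hxy
      cases hxy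
    · obtain ⟨U, X, hU, hxU⟩ := exists_attachesAt hx hxJ
      obtain ⟨b, hb, hb'⟩ := hρU x U X hU hxU
      obtain ⟨U', X', hU', hyU'⟩ := exists_attachesAt hy hyJ
      obtain ⟨c, hc, hc'⟩ := hρU y U' X' hU' hyU'
      rw [hb', hc'] at hxy
      obtain rfl := Sum.inr.inj hxy
      obtain ⟨b₁, hb₁, hX⟩ := hα X ⟨U, hU⟩
      obtain ⟨b₂, hb₂, hX'⟩ := hα X' ⟨U', hU'⟩
      obtain rfl : b = b₁ := Option.some.inj (hb.symm.trans hb₁)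
      obtain rfl : b = b₂ := Option.some.inj (hc.symm.trans hb₂)
      -- A face determines its vertex set, so components with the same image have the same
      -- separator.
      obtain rfl : X = X' := Set.ext fun z => (hX z).trans (hX' z).symm
      exact Or.inr ⟨X, ⟨U, hU, hxU⟩, ⟨U', hU', hyU'⟩⟩

namespace K33Subdivision

lemma left_mem (S : K33Subdivision F) (i j : Fin 3) :
    S.left i ∈ (S.path i j : F.spanningCoe.Walk (S.left i) (S.right j)).support :=
  SimpleGraph.Walk.start_mem_support _

lemma right_mem (S : K33Subdivision F) (i j : Fin 3) :
    S.right j ∈ (S.path i j : F.spanningCoe.Walk (S.left i) (S.right j)).support :=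
  SimpleGraph.Walk.end_mem_support _

/-- Vertices of a walk between different vertices of a subgraph lie in the subgraph. -/
lemma _root_.TwoDRP.mem_verts_of_mem_support {x y z : W} (p : F.spanningCoe.Walk x y)
    (hx : x ∈ F.verts) (hz : z ∈ p.support) : z ∈ F.verts := by
  induction p with
  | nil => simpa using (List.mem_singleton.1 hz) ▸ hx
  | cons h p ih =>
    rw [SimpleGraph.Walk.support_cons, List.mem_cons] at hz
    rcases hz with rfl | hz
    · exact hx
    · exact ih (F.edge_vert (SimpleGraph.Subgraph.Adj.symm h)) hz

lemma mem_verts (S : K33Subdivision F) {i j : Fin 3} {z : W}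
    (hz : z ∈ (S.path i j : F.spanningCoe.Walk (S.left i) (S.right j)).support) : z ∈ F.verts := by
  have hstart : ∀ {x y : W} (_ : F.spanningCoe.Walk x y), x ≠ y → x ∈ F.verts := by
    intro x y p hxy
    cases p with
    | nil => exact absurd rfl hxy
    | cons h p => exact F.edge_vert h
  exact mem_verts_of_mem_support _ (hstart (S.path i j).1 (S.left_ne_right i j)) hz

/-- Some two paths of the subdivision without a common end meet the interior of the same
separator. -/
theorem exists_paths_meeting_interior [Finite W] {C : Root ↪ W} {M : PlanarEmbedding J}
    (h : IsStrongPlanarReductionWith F C J M) (S : K33Subdivision F) :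
    ∃ (X : Set W) (i i' j j' : Fin 3), i ≠ i' ∧ j ≠ j' ∧
      (∃ x ∈ interior F J X,
        x ∈ (S.path i j : F.spanningCoe.Walk (S.left i) (S.right j)).support) ∧
      ∃ x ∈ interior F J X,
        x ∈ (S.path i' j' : F.spanningCoe.Walk (S.left i') (S.right j')).support := by
  classical
  by_contra hcon
  push Not at hcon
  have := Fintype.ofFinite J.verts
  have := Fintype.ofFinite J.coe.Dart
  have : Finite M.Face := Quotient.finite _
  have := Fintype.ofFinite M.Face
  obtain ⟨ρ, hρ, hρ'⟩ := exists_contraction h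
  let T : Fin 3 → Fin 3 → Set (J.verts ⊕ M.Face) := fun i j =>
    ρ '' {x | x ∈ (S.path i j : F.spanningCoe.Walk (S.left i) (S.right j)).support}
  have hch : ∀ i j, M.starred.HasChain (T i j) (ρ (S.left i)) (ρ (S.right j)) := fun i j =>
    DartSystem.hasChain_of_walk (G := F.spanningCoe) hρ (S.path i j).1 _
      fun z hz => ⟨z, hz, rfl⟩
  choose p hp hpb hps using hch
  refine DartSystem.no_K33 (RotationSystem.SimplyConnected.starred M.simplyConnected)
    (fun i => ρ (S.left i)) (fun j => ρ (S.right j)) T p hp hpb hps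
    (fun i j => ⟨_, S.left_mem i j, rfl⟩) (fun i j => ⟨_, S.right_mem i j, rfl⟩) ?_
  intro i i' j j' hi hj
  rw [Set.disjoint_left]
  rintro _ ⟨x, hx, rfl⟩ ⟨y, hy, hxy⟩
  -- A common image of two paths without a common end is either a common vertex, which the
  -- subdivision excludes, or arises from one interior met by both, which `hcon` excludes.
  rcases hρ' y x (S.mem_verts hy) (S.mem_verts hx) hxy with rfl | ⟨X, hyX, hxX⟩
  · rcases S.inter i j i' j' y (by simp [hi]) hx hy with h | h
    · exact hi h.1
    · exact hj h.1
  · exact hcon X i i' j j' hi hj ⟨x, hxX, hx⟩ y hyX hy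

end K33Subdivision

end Contraction

/-! ### Counting the centers on the two sides of a small separator. -/

section Walks

variable {V : Type u} {G : SimpleGraph V}

/-- A walk into a set meets the boundary of the set. -/
lemma exists_mem_support_of_boundary {K X : Set V}
    (hK : ∀ a b, a ∈ K → G.Adj a b → b ∈ K ∨ b ∈ X) {x y : V} (p : G.Walk x y) (hx : x ∉ K)
    (hy : y ∈ K) : ∃ z ∈ p.support, z ∈ X := by
  induction p with
  | nil => exact absurd hy hx
  | @cons x z y h p ih =>
    by_cases hz : z ∈ K
    · exact ⟨x, by simp, (hK z x hz h.symm).resolve_left hx⟩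
    · obtain ⟨w, hw, hwX⟩ := ih hz hy
      exact ⟨w, by simp [hw], hwX⟩

lemma eq_of_mem_takeUntil_of_mem_dropUntil [DecidableEq V] {x y a z : V} {p : G.Walk x y}
    (hp : p.IsPath) (ha : a ∈ p.support) (hz : z ∈ (p.takeUntil a ha).support)
    (hz' : z ∈ (p.dropUntil a ha).support) : z = a := by
  by_contra hne
  rw [← p.take_spec ha] at hp
  exact hp.ne_of_mem_support_of_append hne hz hz' rfl

/-- A path that visits a set and has both ends outside meets the boundary of the set twice. -/
lemma exists_two_mem_support_of_boundary {K X : Set V}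
    (hK : ∀ a b, a ∈ K → G.Adj a b → b ∈ K ∨ b ∈ X) (hKX : Disjoint K X) {x y a : V}
    {p : G.Walk x y} (hp : p.IsPath) (hx : x ∉ K) (hy : y ∉ K) (ha : a ∈ p.support) (haK : a ∈ K) :
    ∃ z ∈ p.support, ∃ w ∈ p.support, z ≠ w ∧ z ∈ X ∧ w ∈ X := by
  classical
  obtain ⟨z, hz, hzX⟩ := exists_mem_support_of_boundary hK (p.takeUntil a ha) hx haK
  obtain ⟨w, hw, hwX⟩ := exists_mem_support_of_boundary hK (p.dropUntil a ha).reverse hy haK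
  rw [SimpleGraph.Walk.support_reverse, List.mem_reverse] at hw
  refine ⟨z, p.support_takeUntil_subset_support ha hz, w, p.support_dropUntil_subset_support ha hw, ?_, hzX, hwX⟩
  rintro rfl
  obtain rfl := eq_of_mem_takeUntil_of_mem_dropUntil hp ha hz hw
  exact Set.disjoint_left.1 hKX haK hzX

end Walks

namespace K33Subdivision

variable {V : Type u} {F : VGraph V} (S : K33Subdivision F)

/-- The vertices of the path between two centers. -/
def pathSet (i j : Fin 3) : Set V :=
  {x | x ∈ (S.path i j : F.spanningCoe.Walk (S.left i) (S.right j)).support}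

/-- The subdivision with its sides exchanged. -/
def swap : K33Subdivision F where
  left := S.right
  right := S.left
  path i j := (S.path j i).reverse
  left_injective := S.right_injective
  right_injective := S.left_injective
  left_ne_right i j := (S.left_ne_right j i).symm
  inter i j i' j' x h hx hx' := by
    have := S.inter j i j' i' x (by simpa [and_comm] using h) (by simpa using hx)
      (by simpa using hx')
    exact this.symm

lemma pathSet_swap (i j : Fin 3) : S.swap.pathSet i j = S.pathSet j i := by
  ext x
  simp [pathSet, swap]

lemma left_mem_pathSet (i j : Fin 3) : S.left i ∈ S.pathSet i j := S.left_mem i j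

lemma right_mem_pathSet (i j : Fin 3) : S.right j ∈ S.pathSet i j := S.right_mem i j

lemma disjoint_pathSet {i i' j j' : Fin 3} (hi : i ≠ i') (hj : j ≠ j') {x : V}
    (hx : x ∈ S.pathSet i j) (hx' : x ∈ S.pathSet i' j') : False := by
  rcases S.inter i j i' j' x (by simp [hi]) hx hx' with h | h
  · exact hi h.1
  · exact hj h.1

lemma eq_right {i i' j j' : Fin 3} (hi : i ≠ i') {x : V}
    (hx : x ∈ S.pathSet i j) (hx' : x ∈ S.pathSet i' j') : j = j' ∧ x = S.right j := by
  rcases S.inter i j i' j' x (by simp [hi]) hx hx' with h | h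
  · exact absurd h.1 hi
  · exact h

lemma eq_left {i i' j j' : Fin 3} (hj : j ≠ j') {x : V}
    (hx : x ∈ S.pathSet i j) (hx' : x ∈ S.pathSet i' j') : i = i' ∧ x = S.left i := by
  rcases S.inter i j i' j' x (by simp [hj]) hx hx' with h | h
  · exact h
  · exact absurd h.1 hj

variable {S} {K X : Set V}

lemma exists_mem_pathSet (hK : ∀ a b, a ∈ K → F.Adj a b → b ∈ K ∨ b ∈ X) {i j : Fin 3}
    (h : (S.left i ∈ K ∧ S.right j ∉ K) ∨ (S.left i ∉ K ∧ S.right j ∈ K)) :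
    ∃ x ∈ S.pathSet i j, x ∈ X := by
  rcases h with h | h
  · obtain ⟨x, hx, hxX⟩ := exists_mem_support_of_boundary (G := F.spanningCoe) hK
      (S.path i j).1.reverse h.2 h.1
    rw [SimpleGraph.Walk.support_reverse, List.mem_reverse] at hx
    exact ⟨x, hx, hxX⟩
  · exact exists_mem_support_of_boundary (G := F.spanningCoe) hK (S.path i j).1 h.1 h.2

lemma exists_two_mem_pathSet (hK : ∀ a b, a ∈ K → F.Adj a b → b ∈ K ∨ b ∈ X)
    (hKX : Disjoint K X) {i j : Fin 3} (hi : S.left i ∉ K) (hj : S.right j ∉ K)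
    (h : ∃ a ∈ K, a ∈ S.pathSet i j) :
    ∃ x ∈ S.pathSet i j, ∃ y ∈ S.pathSet i j, x ≠ y ∧ x ∈ X ∧ y ∈ X := by
  obtain ⟨a, haK, ha⟩ := h
  exact exists_two_mem_support_of_boundary (G := F.spanningCoe) hK hKX (S.path i j).2 hi hj ha haK

/-- If `left k` is the only center in `K`, paths not ending at `left k` avoid `K`. -/
lemma not_meets_of_left_mem [Finite V] (hK : ∀ a b, a ∈ K → F.Adj a b → b ∈ K ∨ b ∈ X)
    (hKX : Disjoint K X) (hX : X.ncard ≤ 3) {k : Fin 3} (hk : S.left k ∈ K)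
    (hl : ∀ i, i ≠ k → S.left i ∉ K) (hr : ∀ j, S.right j ∉ K) {a b : Fin 3} (hak : a ≠ k) :
    ¬ ∃ x ∈ K, x ∈ S.pathSet a b := by
  intro h
  obtain ⟨y, hy, z, hz, hyz, hyX, hzX⟩ := exists_two_mem_pathSet hK hKX (hl a hak) (hr b) h
  -- The three paths from `left k` leave `K` through different vertices and so use up `X`. A path
  -- from another left center can share only its right end with them, but a visit to `K` would need
  -- two vertices of `X`.
  choose x hx hxX using fun m => exists_mem_pathSet (S := S) (j := m) hK (Or.inl ⟨hk, hr m⟩)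
  have hne : ∀ m, x m ≠ S.left k := fun m h =>
    Set.disjoint_left.1 hKX (h ▸ hk : x m ∈ K) (hxX m)
  have hinj : Function.Injective x := by
    intro m m' h
    by_contra hmm
    exact hne m (S.eq_left hmm (hx m) (h ▸ hx m')).2
  have hrange : Set.range x = X := by
    refine Set.eq_of_subset_of_ncard_le (by rintro _ ⟨m, rfl⟩; exact hxX m) ?_
    rw [← Set.image_univ, Set.ncard_image_of_injective _ hinj, Set.ncard_univ]
    simpa using hX
  have key : ∀ w ∈ S.pathSet a b, w ∈ X → w = S.right b := by
    intro w hw hwX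
    rw [← hrange] at hwX
    obtain ⟨m, rfl⟩ := hwX
    exact (S.eq_right hak hw (hx m)).2
  exact hyz ((key y hy hyX).trans (key z hz hzX).symm)

/-- The six centers, indexed by the two sides. -/
def center (S : K33Subdivision F) : Fin 3 ⊕ Fin 3 → V := Sum.elim S.left S.right

lemma center_injective : Function.Injective S.center := by
  rintro (i | i) (j | j) h
  · exact congrArg Sum.inl (S.left_injective h)
  · exact absurd h (S.left_ne_right i j)
  · exact absurd h.symm (S.left_ne_right j i)
  · exact congrArg Sum.inr (S.right_injective h)

/-- A vertex assignment of `K₃,₃` with two vertices in class `0` and two in class `2` has at least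
four vertices in class `1` or edges between the classes `0` and `2`. -/
lemma four_le_crossing (f g : Fin 3 → Fin 3)
    (h₀ : 2 ≤ (Finset.univ.filter fun i => f i = 0).card + (Finset.univ.filter fun i => g i = 0).card)
    (h₂ : 2 ≤ (Finset.univ.filter fun i => f i = 2).card +
      (Finset.univ.filter fun i => g i = 2).card) :
    4 ≤ (Finset.univ.filter fun i => f i = 1).card + (Finset.univ.filter fun i => g i = 1).card +
      (Finset.univ.filter fun e : Fin 3 × Fin 3 =>
        (f e.1 = 0 ∧ g e.2 = 2) ∨ (f e.1 = 2 ∧ g e.2 = 0)).card := by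
  revert f g
  decide +kernel

/-- A set with at most three boundary vertices cannot have two centers inside and two outside. -/
lemma not_two_two [Finite V] (hK : ∀ a b, a ∈ K → F.Adj a b → b ∈ K ∨ b ∈ X)
    (hX : X.ncard ≤ 3) {f g : Fin 3 → Fin 3}
    (hf₀ : ∀ i, f i = 0 ↔ S.left i ∈ K) (hf₁ : ∀ i, f i = 1 ↔ S.left i ∈ X)
    (hg₀ : ∀ i, g i = 0 ↔ S.right i ∈ K) (hg₁ : ∀ i, g i = 1 ↔ S.right i ∈ X)
    (h₀ : 2 ≤ (Finset.univ.filter fun i => f i = 0).card + (Finset.univ.filter fun i => g i = 0).card)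
    (h₂ : 2 ≤ (Finset.univ.filter fun i => f i = 2).card +
      (Finset.univ.filter fun i => g i = 2).card) : False := by
  have hcard := four_le_crossing f g h₀ h₂
  have hout : ∀ a b : Fin 3, (a = 0 ∧ b = 2) ∨ (a = 2 ∧ b = 0) →
      (a = 0 ∧ b ≠ 0) ∨ (a ≠ 0 ∧ b = 0) := by decide
  have hout' : ∀ a b : Fin 3, (a = 0 ∧ b = 2) ∨ (a = 2 ∧ b = 0) → a ≠ 1 ∧ b ≠ 1 := by decide
  have hcross : ∀ e : {e : Fin 3 × Fin 3 // (f e.1 = 0 ∧ g e.2 = 2) ∨ (f e.1 = 2 ∧ g e.2 = 0)},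
      ∃ x ∈ S.pathSet e.1.1 e.1.2, x ∈ X := by
    rintro ⟨e, he⟩
    refine exists_mem_pathSet hK ?_
    simpa only [← hf₀, ← hg₀] using hout _ _ he
  choose x hx hxX using hcross
  -- A center on a path is one of its two ends, and the ends of a crossing path have classes 0 and
  -- 2, so neither lies in `X`.
  have hxl : ∀ e i, x e ≠ S.left i := by
    intro e i h
    obtain ⟨j, hj⟩ := exists_ne e.1.2
    obtain ⟨rfl, -⟩ := S.eq_left hj (S.left_mem_pathSet i j) (h ▸ hx e)
    exact (hout' _ _ e.2).1 ((hf₁ _).2 (h ▸ hxX e))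
  have hxr : ∀ e j, x e ≠ S.right j := by
    intro e j h
    obtain ⟨i, hi⟩ := exists_ne e.1.1
    obtain ⟨rfl, -⟩ := S.eq_right hi (S.right_mem_pathSet i j) (h ▸ hx e)
    exact (hout' _ _ e.2).2 ((hg₁ _).2 (h ▸ hxX e))
  -- Centers in `X` and crossing paths inject into `X`; there are at least four of them.
  let E := ({i // f i = 1} ⊕ {j // g j = 1}) ⊕
    {e : Fin 3 × Fin 3 // (f e.1 = 0 ∧ g e.2 = 2) ∨ (f e.1 = 2 ∧ g e.2 = 0)}
  let Ψ : E → X := Sum.elim (Sum.elim (fun i => ⟨S.left i, (hf₁ _).1 i.2⟩)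
    (fun j => ⟨S.right j, (hg₁ _).1 j.2⟩)) (fun e => ⟨x e, hxX e⟩)
  have hΨ : Function.Injective Ψ := by
    rintro ((i | j) | e) ((i' | j') | e') h <;>
      replace h := congrArg Subtype.val h <;> simp only [Ψ, Sum.elim_inl, Sum.elim_inr] at h
    · rw [Subtype.ext (S.left_injective h)]
    · exact absurd h (S.left_ne_right _ _)
    · exact absurd h.symm (hxl _ _)
    · exact absurd h.symm (S.left_ne_right _ _)
    · rw [Subtype.ext (S.right_injective h)]
    · exact absurd h.symm (hxr _ _)
    · exact absurd h (hxl _ _)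
    · exact absurd h (hxr _ _)
    · have h₁ := hx e
      have h₂ := hx e'
      rw [← h] at h₂
      congr 1
      refine Subtype.ext (Prod.ext ?_ ?_)
      · by_contra hne
        exact hxr e _ (S.eq_right hne h₁ h₂).2
      · by_contra hne
        exact hxl e _ (S.eq_left hne h₁ h₂).2
  have hle := Nat.card_le_card_of_injective Ψ hΨ
  rw [Nat.card_coe_set_eq, Nat.card_eq_fintype_card, Fintype.card_sum, Fintype.card_sum,
    Fintype.card_subtype, Fintype.card_subtype, Fintype.card_subtype] at hle
  omega

/-- If two paths without a common end meet a set with at most three boundary vertices, the set and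
its boundary contain at least five centers. -/
theorem five_le_ncard_of_meets [Finite V] (hK : ∀ a b, a ∈ K → F.Adj a b → b ∈ K ∨ b ∈ X)
    (hKX : Disjoint K X) (hX : X.ncard ≤ 3) {i i' j j' : Fin 3} (hi : i ≠ i') (hj : j ≠ j')
    (h : ∃ x ∈ K, x ∈ S.pathSet i j) (h' : ∃ x ∈ K, x ∈ S.pathSet i' j') :
    5 ≤ (S.centers ∩ (X ∪ K)).ncard := by
  classical
  -- Class 0 is inside `K`, class 1 is on `X`, and class 2 is outside both.
  have hcls : ∀ v, ∃ a : Fin 3, (a = 0 ↔ v ∈ K) ∧ (a = 1 ↔ v ∈ X) ∧ (a ≠ 2 ↔ v ∈ X ∪ K) := by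
    intro v
    by_cases hvK : v ∈ K
    · have hvX := Set.disjoint_left.1 hKX hvK
      exact ⟨0, by simp [hvK], by simp [hvX], by simp [hvK]⟩
    · by_cases hvX : v ∈ X
      · exact ⟨1, by simp [hvK], by simp [hvX], by simp [hvX]⟩
      · exact ⟨2, by simp [hvK], by simp [hvX], by simp [hvX, hvK]⟩
  choose κ hκ₀ hκ₁ hκ₂ using hcls
  set f : Fin 3 → Fin 3 := fun i => κ (S.left i) with hf
  set g : Fin 3 → Fin 3 := fun i => κ (S.right i) with hg
  have hcount : (S.centers ∩ (X ∪ K)).ncard =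
      (Finset.univ.filter fun i => ¬ f i = 2).card +
        (Finset.univ.filter fun i => ¬ g i = 2).card := by
    have : S.centers ∩ (X ∪ K) = S.center '' {s | κ (S.center s) ≠ 2} := by
      ext v
      simp only [centers, Set.mem_inter_iff, Set.mem_image, Set.mem_ofPred_eq, hκ₂]
      constructor
      · rintro ⟨⟨i, rfl⟩ | ⟨i, rfl⟩, hv⟩
        · exact ⟨Sum.inl i, hv, rfl⟩
        · exact ⟨Sum.inr i, hv, rfl⟩
      · rintro ⟨i | i, hv, rfl⟩
        · exact ⟨Or.inl ⟨i, rfl⟩, hv⟩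
        · exact ⟨Or.inr ⟨i, rfl⟩, hv⟩
    rw [this, Set.ncard_image_of_injective _ S.center_injective, Set.ncard_eq_toFinset_card',
      Set.toFinset_ofPred]
    simp only [Finset.card_filter, Fintype.sum_sum_type]
    rfl
  by_contra hlt
  have hf2 := Finset.card_filter_add_card_filter_not (s := (Finset.univ : Finset (Fin 3)))
    (fun i => f i = 2)
  have hg2 := Finset.card_filter_add_card_filter_not (s := (Finset.univ : Finset (Fin 3)))
    (fun i => g i = 2)
  simp only [Finset.card_univ, Fintype.card_fin] at hf2 hg2
  -- Fewer than five centers in `X ∪ K` leave two outside, so at most one can be in `K`.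
  have h₀ : (Finset.univ.filter fun i => f i = 0).card +
      (Finset.univ.filter fun i => g i = 0).card ≤ 1 := by
    by_contra h₀
    exact not_two_two (S := S) hK hX (f := f) (g := g) (fun _ => hκ₀ _) (fun _ => hκ₁ _)
      (fun _ => hκ₀ _) (fun _ => hκ₁ _) (by omega) (by omega)
  have hle : ∀ (u : Fin 3 → Fin 3) (a b : Fin 3), (Finset.univ.filter fun i => u i = 0).card ≤ 1 →
      u a = 0 → b ≠ a → u b ≠ 0 := by
    intro u a b hu ha hb hb'
    exact hb (Finset.card_le_one.1 hu b (by simp [hb']) a (by simp [ha]))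
  have hpos : ∀ (u : Fin 3 → Fin 3) (a : Fin 3), u a = 0 →
      0 < (Finset.univ.filter fun i => u i = 0).card := fun u a ha =>
    Finset.card_pos.2 ⟨a, by simp [ha]⟩
  by_cases hL : ∃ k, S.left k ∈ K
  · obtain ⟨k, hk⟩ := hL
    have hk' := hpos f k ((hκ₀ _).2 hk)
    have hl : ∀ i, i ≠ k → S.left i ∉ K := fun i hik hi =>
      hle f k i (by omega) ((hκ₀ _).2 hk) hik ((hκ₀ _).2 hi)
    have hr : ∀ j, S.right j ∉ K := fun j hj => by
      have := hpos g j ((hκ₀ _).2 hj)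
      omega
    rcases eq_or_ne i k with rfl | hik
    · exact not_meets_of_left_mem hK hKX hX hk hl hr hi.symm h'
    · exact not_meets_of_left_mem hK hKX hX hk hl hr hik h
  · push Not at hL
    by_cases hR : ∃ k, S.right k ∈ K
    · obtain ⟨k, hk⟩ := hR
      have hk' := hpos g k ((hκ₀ _).2 hk)
      have hr : ∀ i, i ≠ k → S.swap.left i ∉ K := fun i hik hi =>
        hle g k i (by omega) ((hκ₀ _).2 hk) hik ((hκ₀ _).2 hi)
      rw [← S.pathSet_swap] at h h'
      rcases eq_or_ne j k with rfl | hjk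
      · exact not_meets_of_left_mem (S := S.swap) hK hKX hX hk hr hL hj.symm h'
      · exact not_meets_of_left_mem (S := S.swap) hK hKX hX hk hr hL hjk h
    · push Not at hR
      -- With no center in `K`, each of the two disjoint paths enters and leaves `K`, which needs
      -- four vertices of `X`.
      obtain ⟨a, ha, b, hb, hab, haX, hbX⟩ := exists_two_mem_pathSet hK hKX (hL i) (hR j) h
      obtain ⟨c, hc, d, hd, hcd, hcX, hdX⟩ := exists_two_mem_pathSet hK hKX (hL i') (hR j') h'
      have hne : ∀ u ∈ S.pathSet i j, ∀ w ∈ S.pathSet i' j', u ≠ w := by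
        rintro u hu w hw rfl
        exact S.disjoint_pathSet hi hj hu hw
      have hsub : ({a, b, c, d} : Set V) ⊆ X := by
        rintro v (rfl | rfl | rfl | rfl) <;> assumption
      have hcard : ({a, b, c, d} : Set V).ncard = 4 := by
        rw [Set.ncard_insert_of_notMem, Set.ncard_insert_of_notMem, Set.ncard_pair hcd]
        · simp [hne b hb c hc, hne b hb d hd]
        · simp [hab, hne a ha c hc, hne a ha d hd]
      have := Set.ncard_le_ncard hsub
      omega

end K33Subdivision

/-- The lemma on subdivisions: five of the six centers lie in the part cut off by one triangle. -/
theorem exists_triangle_five_centers {W : Type u} [Finite W] {F J : VGraph W} {C : Root ↪ W}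
    {M : PlanarEmbedding J} (h : IsStrongPlanarReductionWith F C J M) (S : K33Subdivision F) :
    ∃ X, M.IsTriangularFace X ∧ (∃ U, AttachesAt F J U X) ∧
      5 ≤ (S.centers ∩ (X ∪ interior F J X)).ncard := by
  obtain ⟨X, i, i', j, j', hi, hj, h₁, h₂⟩ := S.exists_paths_meeting_interior h
  obtain ⟨x, ⟨U, hU, -⟩, -⟩ := id h₁
  exact ⟨X, h.2 U X hU, ⟨U, hU⟩, K33Subdivision.five_le_ncard_of_meets
    (fun a b ha hab => interior_boundary ha hab) (interior_disjoint hU.subset_verts)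
    (h.1.ncard_separator_le hU) hi hj h₁ h₂⟩

/-! ### The neighbours of `v*` in root graphs, reductions and compactions. -/

section RootNeighbors

variable {V : Type u} {C : Root ↪ V}

/-- All neighbours of `v*` are root vertices. -/
def RootNeighbors (K : VGraph V) (C : Root ↪ V) : Prop :=
  ∀ x, K.Adj (C .vstar) x → x ∈ Set.range C

lemma rootNeighbors_auxGraph {G : VGraph V} (h : IsInstance G C) :
    RootNeighbors (auxGraph G C) C := by
  rintro x (hx | hx)
  · exact absurd (G.edge_vert hx) h.1
  · obtain ⟨a, b, -, -, rfl⟩ := (SimpleGraph.map_adj C wheel _ _).1 hx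
    exact ⟨b, rfl⟩

lemma RootNeighbors.mono {K K' : VGraph V} (h : RootNeighbors K C) (hle : K' ≤ K) :
    RootNeighbors K' C := fun x hx => h x (hle.2 hx)

lemma RootNeighbors.of_blockStep {K K' : VGraph V} (h : RootNeighbors K C)
    (hs : BlockStep C K K') : RootNeighbors K' C := by
  obtain ⟨U, X, -, -, rfl⟩ := hs
  exact h.mono SimpleGraph.Subgraph.deleteVerts_le

/-- The new edge is not at `v*`: every vertex of the cut has a neighbour in the deleted piece, which
contains no root vertex. -/
lemma RootNeighbors.of_twoCutStep {K K' : VGraph V} (h : RootNeighbors K C)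
    (hs : TwoCutStep C K K') : RootNeighbors K' C := by
  obtain ⟨U, X, ⟨-, -, hUC, hX⟩, -, rfl⟩ := hs
  rintro x (hx | hx)
  · exact h x (SimpleGraph.Subgraph.deleteVerts_le.2 hx)
  · obtain ⟨a, ha, hax⟩ := hX _ hx.1
    exact absurd (h a hax.symm) (Set.disjoint_left.1 hUC ha)

lemma IsRootGraph.rootNeighbors {T : VGraph V} (h : IsRootGraph T C) : RootNeighbors T C := by
  obtain ⟨G, B, hG, hB, -, hT, -⟩ := h
  have hB' : RootNeighbors B C := by
    clear hT
    induction hB with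
    | refl => exact rootNeighbors_auxGraph hG
    | tail _ hs ih => exact ih.of_blockStep hs
  induction hT with
  | refl => exact hB'
  | tail _ hs ih => exact ih.of_twoCutStep hs

/-- If `v*` only has root vertices as neighbours, it lies in no separator of a reduction. -/
lemma RootNeighbors.vstar_notMem {H J : VGraph V} (h : RootNeighbors H C)
    (hJ : IsReduction H C J) {U X : Set V} (hU : AttachesAt H J U X) : C .vstar ∉ X := by
  intro hX
  obtain ⟨a, ha, hadj⟩ := hU.exists_adj hX
  obtain ⟨r, rfl⟩ := h a hadj.symm
  exact hU.notMem ha (hJ.root_mem r)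

/-- Edges added by a reduction join vertices of one separator, and `v*` lies in none. -/
lemma RootNeighbors.of_isReduction {T F : VGraph V} (h : RootNeighbors T C)
    (hF : IsReduction T C F) : RootNeighbors F C := by
  intro x hx
  obtain ⟨-, -, hx | ⟨-, U, X, hU, hX, -⟩⟩ := (hF.adj_iff _ _).1 hx
  · exact h x hx
  · exact absurd hX (h.vstar_notMem hF hU)

lemma RootNeighbors.of_isCompaction {W : Type v} {T : VGraph V} {F : VGraph W} {D : Root ↪ W}
    (h : RootNeighbors T C) (hF : IsCompaction T C F D) : RootNeighbors F D := by
  obtain ⟨-, branch, hconn, hdisj, hadj, hroot, -⟩ := hF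
  -- The branch set of `v*` is a single vertex: the first step of a walk inside it from `v*` would
  -- lead to another root vertex, which belongs to another branch set.
  have hbranch : ∀ x ∈ branch (D .vstar), x = C .vstar := by
    intro x hx
    by_contra hne
    have hc := (hconn _ (hroot .vstar).1).2
    obtain ⟨p⟩ := hc.coe.preconnected ⟨C .vstar, (hroot .vstar).2⟩ ⟨x, hx⟩
    cases p with
    | nil => exact hne rfl
    | @cons _ y _ hy _ =>
      obtain ⟨hv, hy', hTy⟩ := hy
      obtain ⟨r, hr⟩ := h y hTy
      have hrv : D .vstar ≠ D r := fun he =>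
        hTy.ne ((congrArg C (D.injective he)).trans hr)
      exact Set.disjoint_left.1 (hdisj (hroot .vstar).1 (hroot r).1 hrv) hy' (hr ▸ (hroot r).2)
  intro w hw
  obtain ⟨x, hx, y, hy, hxy⟩ := hadj _ _ hw
  obtain rfl := hbranch x hx
  obtain ⟨r, rfl⟩ := h y hxy
  refine ⟨r, ?_⟩
  by_contra hne
  exact Set.disjoint_left.1 (hdisj (hroot r).1 (F.edge_vert hw.symm) hne) (hroot r).2 hy

lemma rootNeighbors_of_reduction_or_compaction {W : Type v} {F : VGraph W} {D : Root ↪ W}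
    (h : IsReductionOfRootGraph F D ∨ IsCompactionOfRootGraph.{u, v} F D) : RootNeighbors F D := by
  rcases h with ⟨T, hT, hF⟩ | ⟨V, _, T, C, hT, hF⟩
  · exact hT.rootNeighbors.of_isReduction hF
  · exact hT.rootNeighbors.of_isCompaction hF

lemma threeConnected_of_reduction_or_compaction {W : Type v} {F : VGraph W} {D : Root ↪ W}
    (h : IsReductionOfRootGraph F D ∨ IsCompactionOfRootGraph.{u, v} F D) : IsThreeConnected F := by
  rcases h with ⟨T, hT, hF⟩ | ⟨V, _, T, C, hT, hF⟩
  · exact hF.threeConnected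
  · exact hF.1

end RootNeighbors

/-! ### The two other centers on the side of `v*`. -/

section TwoSides

variable {W : Type u} {F J : VGraph W} {C : Root ↪ W}

/-- A connected subgraph that avoids the separator stays in the component. -/
lemma AttachesAt.subset_of_connected {U X : Set W} (hU : AttachesAt F J U X) {A : VGraph W}
    (hA : A.Connected) (hle : A ≤ F) (hX : Disjoint A.verts X) {a : W} (ha : a ∈ A.verts)
    (haU : a ∈ U) : A.verts ⊆ U := by
  intro x hx
  obtain ⟨p⟩ := hA.coe.preconnected ⟨a, ha⟩ ⟨x, hx⟩
  have key : ∀ {y z : A.verts} (_ : A.coe.Walk y z), (y : W) ∈ U → (z : W) ∈ U := by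
    intro y z p
    induction p with
    | nil => exact id
    | @cons y z _ h p ih =>
      intro hy
      refine ih (hU.mem_of_adj hy (hle.2 h) fun hz => ?_)
      exact Set.disjoint_left.1 hX z.2 (hU.mem_separator hy (hle.2 h) hz)
  exact key p haU

/-- The first corollary, for graphs in which `v*` only has root vertices as neighbours. -/
theorem exists_triangle_two_sides [Finite W] (hF : RootNeighbors F C) (S : K33Subdivision F) {i j k : Fin 3}
    (hij : i ≠ j) (hik : i ≠ k) (hi : S.left i = C .vstar) {A B : VGraph W} (hAF : A ≤ F)
    (hBF : B ≤ F) (hA : A.Connected) (hB : B.Connected) (hAS : A.verts ∩ S.verts = S.openStar j)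
    (hBS : B.verts ∩ S.verts = S.openStar k) {M : PlanarEmbedding J}
    (h : IsStrongPlanarReductionWith F C J M) :
    ∃ X, M.IsTriangularFace X ∧ (∃ U, AttachesAt F J U X ∧ A.verts ⊆ U) ∧
      ∃ U, AttachesAt F J U X ∧ B.verts ⊆ U := by
  obtain ⟨X, hX, ⟨U₀, hU₀⟩, h5⟩ := exists_triangle_five_centers h S
  -- This makes `v*` the one center that may be missing from the five.
  have hv : C .vstar ∉ X ∪ interior F J X := by
    rintro (hv | ⟨U, hU, hv⟩)
    · exact hF.vstar_notMem h.1 hU₀ hv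
    · exact hU.notMem hv (h.1.root_mem _)
  -- all other centers lie in the part cut off by `X`
  have hcen : ∀ s, S.center s ≠ C .vstar → S.center s ∈ X ∪ interior F J X := by
    intro s hs
    by_contra hsX
    have hne : s ≠ Sum.inl i := fun h => hs (h ▸ hi)
    have hsub : S.centers ∩ (X ∪ interior F J X) ⊆
        S.center '' ({s, Sum.inl i}ᶜ : Set (Fin 3 ⊕ Fin 3)) := by
      rintro v ⟨hvS, hvX⟩
      have : ∃ t, S.center t = v := by
        rcases hvS with ⟨t, rfl⟩ | ⟨t, rfl⟩
        · exact ⟨Sum.inl t, rfl⟩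
        · exact ⟨Sum.inr t, rfl⟩
      obtain ⟨t, rfl⟩ := this
      refine ⟨t, ?_, rfl⟩
      rintro (rfl | rfl)
      · exact hsX hvX
      · exact hv (hi ▸ hvX)
    have hle := Set.ncard_le_ncard hsub
    have hcomp := Set.ncard_add_ncard_compl ({s, Sum.inl i} : Set (Fin 3 ⊕ Fin 3))
    rw [Set.ncard_pair hne] at hcomp
    rw [Set.ncard_image_of_injective _ S.center_injective] at hle
    have : Nat.card (Fin 3 ⊕ Fin 3) = 6 := by simp
    omega
  have hK : ∀ a b, a ∈ interior F J X → F.Adj a b → b ∈ interior F J X ∨ b ∈ X :=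
    fun a b ha hab => interior_boundary ha hab
  have hvK : S.left i ∉ interior F J X := fun h => hv (hi ▸ Or.inr h)
  -- Each path from `v*` to a right center meets `X`. The three vertices found differ, since these
  -- paths share only `v*`, so they are all of `X`.
  have hx : ∀ m, ∃ x ∈ S.pathSet i m, x ∈ X := by
    intro m
    rcases hcen (Sum.inr m) (fun h => S.left_ne_right i m (hi.trans h.symm)) with h | h
    · exact ⟨_, S.right_mem_pathSet i m, h⟩
    · exact K33Subdivision.exists_mem_pathSet hK (Or.inr ⟨hvK, h⟩)
  choose x hxS hxX using hx
  have hinj : Function.Injective x := by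
    intro m m' hmm
    by_contra hne
    have := (S.eq_left hne (hxS m) (hmm ▸ hxS m')).2
    exact hv (hi ▸ this ▸ Or.inl (hxX m))
  have hrange : Set.range x = X := by
    refine Set.eq_of_subset_of_ncard_le (by rintro _ ⟨m, rfl⟩; exact hxX m) ?_
    rw [← Set.image_univ, Set.ncard_image_of_injective _ hinj, Set.ncard_univ]
    simpa using h.1.ncard_separator_le hU₀
  have hside : ∀ (l : Fin 3) (A : VGraph W), i ≠ l → A ≤ F → A.Connected →
      A.verts ∩ S.verts = S.openStar l → ∃ U, AttachesAt F J U X ∧ A.verts ⊆ U := by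
    intro l A hil hAF hA hAS
    -- Every vertex of `X` is on a path from `v*`. Such a path can meet one from `left l` only in a
    -- right center, and the open star contains no end of that kind.
    have hAX : Disjoint A.verts X := by
      rw [Set.disjoint_left]
      intro z hzA hzX
      rw [← hrange] at hzX
      obtain ⟨m, rfl⟩ := hzX
      have : x m ∈ S.openStar l := hAS ▸ ⟨hzA, ⟨i, m, hxS m⟩⟩
      obtain ⟨m', hm', hne⟩ := this
      exact hne (S.eq_right hil.symm hm' (hxS m)).2
    have hlA : S.left l ∈ A.verts := by
      have : S.left l ∈ S.openStar l := ⟨0, S.left_mem _ _, S.left_ne_right _ _⟩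
      rw [← hAS] at this
      exact this.1
    rcases hcen (Sum.inl l) (fun h => hil (S.left_injective (hi.trans h.symm))) with h | h
    · exact absurd h (Set.disjoint_left.1 hAX hlA)
    · obtain ⟨U, hU, hlU⟩ := h
      exact ⟨U, hU, hU.subset_of_connected hA hAF hAX hlA hlU⟩
  exact ⟨X, hX, hside j A hij hAF hA hAS, hside k B hik hBF hB hBS⟩

end TwoSides

/-! ### Menger's theorem -/

section Menger

variable {V : Type u} {G : SimpleGraph V} {A B S : Set V}

/-- Every walk from `A` to `B` meets `S`. -/
def Separates (G : SimpleGraph V) (A B S : Set V) : Prop :=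
  ∀ a ∈ A, ∀ b ∈ B, ∀ p : G.Walk a b, ∃ z ∈ p.support, z ∈ S

/-- There are `k` disjoint paths from `A` to `B`. -/
def Linked (G : SimpleGraph V) (A B : Set V) (k : ℕ) : Prop :=
  ∃ (a b : Fin k → V) (p : ∀ i, G.Walk (a i) (b i)), (∀ i, (p i).IsPath) ∧ (∀ i, a i ∈ A) ∧
    (∀ i, b i ∈ B) ∧ ∀ i j, i ≠ j → ∀ z ∈ (p i).support, z ∉ (p j).support

/-- A walk either avoids an edge or contains walks to one end and from the other end of the edge
that avoid it. -/
lemma exists_walk_deleteEdges (e : Sym2 V) {a b : V} (p : G.Walk a b) :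
    (∃ q : (G.deleteEdges {e}).Walk a b, q.support ⊆ p.support) ∨
      ∃ x y, s(x, y) = e ∧ (∃ q : (G.deleteEdges {e}).Walk a x, q.support ⊆ p.support) ∧
        ∃ q : (G.deleteEdges {e}).Walk y b, q.support ⊆ p.support := by
  induction p with
  | nil => exact Or.inl ⟨.nil, by simp⟩
  | @cons a v b h p ih =>
    have hsub : p.support ⊆ (SimpleGraph.Walk.cons h p).support := by simp
    have hcons : ∀ {z} (h' : (G.deleteEdges {e}).Adj a v) (q : (G.deleteEdges {e}).Walk v z),
        q.support ⊆ p.support → (q.cons h').support ⊆ (SimpleGraph.Walk.cons h p).support := by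
      intro z h' q hq
      simpa using List.Subset.trans hq (List.subset_cons_self _ _)
    by_cases he : s(a, v) = e
    · rcases ih with ⟨q, hq⟩ | ⟨x, y, hxy, -, q, hq⟩
      · exact Or.inr ⟨a, v, he, ⟨.nil, by simp⟩, q, List.Subset.trans hq hsub⟩
      · rw [← he, Sym2.eq_iff] at hxy
        rcases hxy with ⟨rfl, rfl⟩ | ⟨rfl, rfl⟩
        · exact Or.inr ⟨x, y, he, ⟨.nil, by simp⟩, q, List.Subset.trans hq hsub⟩
        · exact Or.inl ⟨q, List.Subset.trans hq hsub⟩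
    · have h' : (G.deleteEdges {e}).Adj a v := by simp [h, he]
      rcases ih with ⟨q, hq⟩ | ⟨x, y, hxy, ⟨q, hq⟩, q', hq'⟩
      · exact Or.inl ⟨q.cons h', hcons h' q hq⟩
      · exact Or.inr ⟨x, y, hxy, ⟨q.cons h', hcons h' q hq⟩, q', List.Subset.trans hq' hsub⟩

/-- Combination of two linkages through the two sides of a separator. -/
lemma Linked.combine [Finite V] {G' : SimpleGraph V} {x y : V} {k : ℕ} (hle : G' ≤ G)
    (hxy : G.Adj x y) (hS : Separates G' A B S) (hx : x ∉ S) (hy : y ∉ S) (hk : S.ncard + 1 = k)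
    (h₁ : Linked G' A (insert x S) k) (h₂ : Linked G' (insert y S) B k) : Linked G A B k := by
  classical
  obtain ⟨a, s, p, hp, ha, hs, hpd⟩ := h₁
  obtain ⟨t, b, q, hq, ht, hb, hqd⟩ := h₂
  have hsinj : Function.Injective s := fun i j h => by
    by_contra hij
    refine hpd i j hij _ (p i).end_mem_support ?_
    rw [h]
    exact (p j).end_mem_support
  have htinj : Function.Injective t := fun i j h => by
    by_contra hij
    refine hqd i j hij _ (q i).start_mem_support ?_
    rw [h]
    exact (q j).start_mem_support
  have hrange : ∀ {w : V} {f : Fin k → V}, w ∉ S → Function.Injective f →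
      (∀ i, f i ∈ insert w S) → Set.range f = insert w S := by
    intro w f hw hf hfS
    refine Set.eq_of_subset_of_ncard_le (by rintro _ ⟨i, rfl⟩; exact hfS i) ?_
    rw [Set.ncard_insert_of_notMem hw, hk, ← Set.image_univ, Set.ncard_image_of_injective _ hf,
      Set.ncard_univ]
    simp
  -- The `k` disjoint paths have `k` different ends in a set of size `k`, so every vertex of that
  -- set is used.
  have hsr := hrange hx hsinj hs
  have htr := hrange hy htinj ht
  have hpS : ∀ i, ∀ z ∈ (p i).support, z ∈ S → z = s i := by
    intro i z hz hzS
    have : z ∈ Set.range s := hsr ▸ Or.inr hzS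
    obtain ⟨j, rfl⟩ := this
    by_contra hne
    exact hpd j i (fun h => hne (h ▸ rfl)) _ (p j).end_mem_support hz
  have hqS : ∀ i, ∀ z ∈ (q i).support, z ∈ S → z = t i := by
    intro i z hz hzS
    have : z ∈ Set.range t := htr ▸ Or.inr hzS
    obtain ⟨j, rfl⟩ := this
    by_contra hne
    exact hqd j i (fun h => hne (h ▸ rfl)) _ (q j).start_mem_support hz
  -- If a path of the first linkage met one of the second outside `S`, switching paths there would
  -- lead from `A` to `B` around `S`.
  have hpq : ∀ i j, ∀ w ∈ (p i).support, w ∈ (q j).support → w ∈ S := by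
    intro i j w hwp hwq
    by_contra hwS
    obtain ⟨z, hz, hzS⟩ := hS _ (ha i) _ (hb j) (((p i).takeUntil w hwp).append
      ((q j).dropUntil w hwq))
    rw [SimpleGraph.Walk.mem_support_append_iff] at hz
    rcases hz with hz | hz
    · have hzs := hpS i z ((p i).support_takeUntil_subset_support hwp hz) hzS
      have hne : s i ≠ w := fun h => hwS (h ▸ hzs ▸ hzS)
      exact SimpleGraph.Walk.endpoint_notMem_support_takeUntil (hp i) hwp hne (hzs ▸ hz)
    · have hzt := hqS j z ((q j).support_dropUntil_subset_support hwq hz) hzS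
      subst hzt
      have hzw := eq_of_mem_takeUntil_of_mem_dropUntil (hq j) hwq
        (SimpleGraph.Walk.start_mem_support _) hz
      exact hwS (hzw ▸ hzS)
  -- Paths are joined at their common vertex of `S`, or through the deleted edge from `x` to `y`.
  have hσ : ∀ i, ∃ j, (s i ∈ S ∧ t j = s i) ∨ (s i = x ∧ t j = y) := by
    intro i
    rcases hs i with h | h
    · obtain ⟨j, hj⟩ : y ∈ Set.range t := htr ▸ Or.inl rfl
      exact ⟨j, Or.inr ⟨h, hj⟩⟩
    · obtain ⟨j, hj⟩ : s i ∈ Set.range t := htr ▸ Or.inr h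
      exact ⟨j, Or.inl ⟨h, hj⟩⟩
  choose σ hσ using hσ
  have hσinj : Function.Injective σ := by
    intro i j hij
    have hi := hσ i
    have hj := hσ j
    rw [hij] at hi
    apply hsinj
    rcases hi with ⟨hi, hi'⟩ | ⟨hi, hi'⟩ <;> rcases hj with ⟨hj, hj'⟩ | ⟨hj, hj'⟩
    · exact hi'.symm.trans hj'
    · exact absurd (hj' ▸ hi' ▸ hi) hy
    · exact absurd (hi' ▸ hj' ▸ hj) hy
    · exact hi.trans hj.symm
  have hr : ∀ i, ∃ r : G.Walk (a i) (b (σ i)), ∀ z ∈ r.support,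
      z ∈ (p i).support ∨ z ∈ (q (σ i)).support := by
    intro i
    have hlink : s i = t (σ i) ∨ G.Adj (s i) (t (σ i)) := by
      rcases hσ i with ⟨-, h⟩ | ⟨h, h'⟩
      · exact Or.inl h.symm
      · exact Or.inr (by rwa [h, h'])
    rcases hlink with h | h
    · refine ⟨((p i).mapLe hle).append (((q (σ i)).mapLe hle).copy h.symm rfl), fun z hz => ?_⟩
      simpa [SimpleGraph.Walk.mem_support_append_iff] using hz
    · refine ⟨((p i).mapLe hle).append (((q (σ i)).mapLe hle).cons h), fun z hz => ?_⟩
      simp only [SimpleGraph.Walk.mem_support_append_iff, SimpleGraph.Walk.support_mapLe_eq_support,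
        SimpleGraph.Walk.support_cons, List.mem_cons] at hz
      rcases hz with hz | rfl | hz
      · exact Or.inl hz
      · exact Or.inl (p i).end_mem_support
      · exact Or.inr hz
  choose r hr using hr
  have hmix : ∀ i j, i ≠ j → ∀ z ∈ (p i).support, z ∉ (q (σ j)).support := by
    intro i j hij z hz hz'
    have hzS := hpq i (σ j) z hz hz'
    have h₁ := hpS i z hz hzS
    have h₂ := hqS (σ j) z hz' hzS
    rcases hσ j with ⟨-, h⟩ | ⟨-, h⟩
    · exact hij (hsinj (h₁.symm.trans (h₂.trans h)))
    · exact hy (h ▸ h₂ ▸ hzS)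
  refine ⟨a, fun i => b (σ i), fun i => (r i).bypass, fun i => (r i).bypass_isPath, ha,
    fun i => hb _, fun i j hij z hz hz' => ?_⟩
  rcases hr i z ((r i).support_bypass_subset_support hz) with h | h <;>
    rcases hr j z ((r j).support_bypass_subset_support hz') with h' | h'
  · exact hpd i j hij z h h'
  · exact hmix i j hij z h h'
  · exact hmix j i hij.symm z h' h
  · exact hqd _ _ (hσinj.ne hij) z h h'

/-- Menger's theorem. -/
theorem linked_of_forall_separates [Finite V] (k : ℕ) (G : SimpleGraph V) (A B : Set V)
    (h : ∀ S, Separates G A B S → k ≤ S.ncard) : Linked G A B k := by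
  classical
  induction hn : G.edgeSet.ncard using Nat.strong_induction_on generalizing G A B with
  | _ n ih =>
  subst hn
  by_cases hE : ∃ e, e ∈ G.edgeSet
  · obtain ⟨e, he⟩ := hE
    set G' := G.deleteEdges {e} with hG'
    have hle : G' ≤ G := SimpleGraph.deleteEdges_le _
    have hlt : G'.edgeSet.ncard < G.edgeSet.ncard := by
      refine Set.ncard_lt_ncard ?_
      rw [hG', SimpleGraph.edgeSet_deleteEdges]
      exact ⟨Set.sdiff_subset, fun hsub => (hsub he).2 rfl⟩
    -- Induction on the number of edges. If `G'` has a separator `S` with fewer than `k` vertices,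
    -- some walk avoiding `S` uses the edge `xy`. Adding either end to `S` separates `A` from `B` in
    -- `G`, so `S` has exactly `k - 1` vertices.
    by_cases hsep : ∀ S, Separates G' A B S → k ≤ S.ncard
    · obtain ⟨a, b, p, hp, ha, hb, hd⟩ := ih _ hlt G' A B hsep rfl
      refine ⟨a, b, fun i => (p i).mapLe hle, fun i => (SimpleGraph.Walk.isPath_mapLe hle).2 (hp i),
        ha, hb, fun i j hij z hz => ?_⟩
      rw [SimpleGraph.Walk.support_mapLe_eq_support] at hz ⊢
      exact hd i j hij z hz
    · push Not at hsep
      obtain ⟨S, hS, hSk⟩ := hsep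
      have hnS : ¬ Separates G A B S := fun hS' => (h S hS').not_gt hSk
      simp only [Separates, not_forall, not_exists, not_and] at hnS
      obtain ⟨a₀, ha₀, b₀, hb₀, p₀, hp₀⟩ := hnS
      rcases exists_walk_deleteEdges e p₀ with ⟨q, hq⟩ | ⟨x, y, rfl, ⟨p₁, hp₁⟩, p₂, hp₂⟩
      · obtain ⟨z, hz, hzS⟩ := hS _ ha₀ _ hb₀ q
        exact absurd hzS (hp₀ z (hq hz))
      have hAy : ∀ a ∈ A, ∀ q : G'.Walk a y, ∃ z ∈ q.support, z ∈ S := by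
        intro a ha q
        obtain ⟨z, hz, hzS⟩ := hS a ha b₀ hb₀ (q.append p₂)
        rw [SimpleGraph.Walk.mem_support_append_iff] at hz
        exact ⟨z, hz.resolve_right fun hz => hp₀ z (hp₂ hz) hzS, hzS⟩
      have hxB : ∀ b ∈ B, ∀ q : G'.Walk x b, ∃ z ∈ q.support, z ∈ S := by
        intro b hb q
        obtain ⟨z, hz, hzS⟩ := hS a₀ ha₀ b hb (p₁.append q)
        rw [SimpleGraph.Walk.mem_support_append_iff] at hz
        exact ⟨z, hz.resolve_left fun hz => hp₀ z (hp₁ hz) hzS, hzS⟩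
      have hins : ∀ w, w = x ∨ w = y → w ∉ S ∧ S.ncard + 1 = k := by
        intro w hw
        have hsep' : Separates G A B (insert w S) := by
          intro a ha b hb p
          rcases exists_walk_deleteEdges s(x, y) p with ⟨q, hq⟩ | ⟨x', y', hxy, ⟨q, hq⟩, q', hq'⟩
          · obtain ⟨z, hz, hzS⟩ := hS a ha b hb q
            exact ⟨z, hq hz, Or.inr hzS⟩
          · refine ⟨w, ?_, Or.inl rfl⟩
            have hx' := hq q.end_mem_support
            have hy' := hq' q'.start_mem_support
            rw [Sym2.eq_iff] at hxy
            rcases hxy with ⟨rfl, rfl⟩ | ⟨rfl, rfl⟩ <;> rcases hw with rfl | rfl <;> assumption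
        have hk := h _ hsep'
        by_cases hwS : w ∈ S
        · rw [Set.insert_eq_of_mem hwS] at hk
          omega
        · rw [Set.ncard_insert_of_notMem hwS] at hk
          exact ⟨hwS, by omega⟩
      -- A set separating `A` from `S ∪ {x}` in `G'` separates `A` from `B` in `G`: a walk to `B`
      -- either meets `S` without using `xy`, or first reaches `x`, or first reaches `y` and meets
      -- `S` on the way by `hAy`.
      have h₁ : Linked G' A (insert x S) k := by
        refine ih _ hlt G' _ _ (fun Z hZ => h Z ?_) rfl
        have hZ' : ∀ {a c : V} (_ : a ∈ A) (q : G'.Walk a c), (∃ z ∈ q.support, z ∈ S) →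
            ∃ z ∈ q.support, z ∈ Z := by
          rintro a c ha q ⟨s, hs, hsS⟩
          obtain ⟨z, hz, hzZ⟩ := hZ a ha s (Or.inr hsS) (q.takeUntil s hs)
          exact ⟨z, q.support_takeUntil_subset_support hs hz, hzZ⟩
        intro a ha b hb p
        rcases exists_walk_deleteEdges s(x, y) p with ⟨q, hq⟩ | ⟨x', y', hxy, ⟨q, hq⟩, -⟩
        · obtain ⟨z, hz, hzZ⟩ := hZ' ha q (hS a ha b hb q)
          exact ⟨z, hq hz, hzZ⟩
        · rw [Sym2.eq_iff] at hxy
          rcases hxy with ⟨rfl, rfl⟩ | ⟨rfl, rfl⟩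
          · obtain ⟨z, hz, hzZ⟩ := hZ a ha _ (Or.inl rfl) q
            exact ⟨z, hq hz, hzZ⟩
          · obtain ⟨z, hz, hzZ⟩ := hZ' ha q (hAy a ha q)
            exact ⟨z, hq hz, hzZ⟩
      have h₂ : Linked G' (insert y S) B k := by
        refine ih _ hlt G' _ _ (fun Z hZ => h Z ?_) rfl
        have hZ' : ∀ {c b : V} (_ : b ∈ B) (q : G'.Walk c b), (∃ z ∈ q.support, z ∈ S) →
            ∃ z ∈ q.support, z ∈ Z := by
          rintro c b hb q ⟨s, hs, hsS⟩
          obtain ⟨z, hz, hzZ⟩ := hZ s (Or.inr hsS) b hb (q.dropUntil s hs)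
          exact ⟨z, q.support_dropUntil_subset_support hs hz, hzZ⟩
        intro a ha b hb p
        rcases exists_walk_deleteEdges s(x, y) p with ⟨q, hq⟩ | ⟨x', y', hxy, -, q, hq⟩
        · obtain ⟨z, hz, hzZ⟩ := hZ' hb q (hS a ha b hb q)
          exact ⟨z, hq hz, hzZ⟩
        · rw [Sym2.eq_iff] at hxy
          rcases hxy with ⟨rfl, rfl⟩ | ⟨rfl, rfl⟩
          · obtain ⟨z, hz, hzZ⟩ := hZ _ (Or.inl rfl) b hb q
            exact ⟨z, hq hz, hzZ⟩
          · obtain ⟨z, hz, hzZ⟩ := hZ' hb q (hxB b hb q)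
            exact ⟨z, hq hz, hzZ⟩
      exact Linked.combine hle he hS (hins x (Or.inl rfl)).1 (hins y (Or.inr rfl)).1
        (hins x (Or.inl rfl)).2 h₁ h₂
  · have hsep : Separates G A B (A ∩ B) := by
      intro a ha b hb p
      cases p with
      | nil => exact ⟨a, by simp, ha, hb⟩
      | cons hadj p => exact absurd ⟨_, (SimpleGraph.mem_edgeSet G).2 hadj⟩ hE
    have hk := h _ hsep
    rw [← Nat.card_coe_set_eq] at hk
    have := Fintype.ofFinite (A ∩ B : Set V)
    rw [Nat.card_eq_fintype_card] at hk
    obtain ⟨f⟩ : Nonempty (Fin k ↪ (A ∩ B : Set V)) :=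
      Function.Embedding.nonempty_of_card_le (by simpa using hk)
    refine ⟨fun i => f i, fun i => f i, fun i => .nil, fun i => .nil, fun i => (f i).2.1,
      fun i => (f i).2.2, fun i j hij z hz hz' => ?_⟩
    rw [SimpleGraph.Walk.support_nil, List.mem_singleton] at hz hz'
    exact hij (f.injective (Subtype.ext (hz.symm.trans hz')))

end Menger

/-! ### Fans, tripods and the K₃,₃ subdivisions built from them. -/

section Fans

variable {W : Type u} {F H J : VGraph W}

/-- In a connected subgraph any two vertices are joined by a walk within it. -/
lemma exists_walk_of_connected {K : VGraph W} (hK : K.Connected) {x y : W} (hx : x ∈ K.verts)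
    (hy : y ∈ K.verts) : ∃ p : K.spanningCoe.Walk x y, ∀ z ∈ p.support, z ∈ K.verts := by
  obtain ⟨p⟩ := hK.coe.preconnected ⟨x, hx⟩ ⟨y, hy⟩
  let f : K.coe →g K.spanningCoe := ⟨Subtype.val, fun h => h⟩
  exact ⟨p.map f, fun z hz => mem_verts_of_mem_support _ hx hz⟩

/-- Three paths from `a` to the vertices `x m` which meet only in `a` and whose vertices other than
the ends `x m` lie in `Z`. -/
def HasFan (F : VGraph W) (Z : Set W) (a : W) (x : Fin 3 → W) : Prop :=
  ∃ p : ∀ m, F.spanningCoe.Walk a (x m), (∀ m, (p m).IsPath) ∧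
    (∀ m, ∀ z ∈ (p m).support, z ∈ Z ∨ z = x m) ∧
    ∀ m m', m ≠ m' → ∀ z ∈ (p m).support, z ∈ (p m').support → z = a

/-- Three fans with the same ends in disjoint sets form a subdivision of `K₃,₃`. -/
lemma exists_subdivision_of_fans {Z : Fin 3 → Set W} {a x : Fin 3 → W}
    (hx : Function.Injective x) (hfan : ∀ i, HasFan F (Z i) (a i) x) (ha : ∀ i, a i ∈ Z i)
    (hZ : ∀ i i', i ≠ i' → Disjoint (Z i) (Z i')) (hZx : ∀ i m, x m ∉ Z i) :
    ∃ S : K33Subdivision F, S.left = a ∧ S.right = x ∧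
      ∀ i m, ∀ z ∈ S.pathSet i m, z ∈ Z i ∨ z = x m := by
  choose p hp hpZ hpd using hfan
  refine ⟨⟨a, x, fun i m => ⟨p i m, hp i m⟩, ?_, hx, ?_, ?_⟩, rfl, rfl, hpZ⟩
  · intro i i' h
    by_contra hne
    exact Set.disjoint_left.1 (hZ i i' hne) (ha i) (h ▸ ha i')
  · intro i m h
    exact hZx i m (h ▸ ha i)
  · intro i m i' m' z hne hz hz'
    rcases eq_or_ne i i' with rfl | hi
    · exact Or.inl ⟨rfl, hpd i m m' (fun h => hne (h ▸ rfl)) z hz hz'⟩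
    · rcases hpZ i m z hz with h | h <;> rcases hpZ i' m' z hz' with h' | h'
      · exact absurd h' (Set.disjoint_left.1 (hZ i i' hi) h)
      · exact absurd (h' ▸ h) (hZx i m')
      · exact absurd (h ▸ h') (hZx i' m)
      · exact Or.inr ⟨hx (h.symm.trans h'), h⟩

/-- The part of a walk up to the first vertex in a set. -/
lemma exists_walk_to_first {G : SimpleGraph W} {Q : Set W} {x y : W} (p : G.Walk x y)
    (hy : y ∈ Q) : ∃ w ∈ Q, ∃ q : G.Walk x w, q.support ⊆ p.support ∧
      ∀ z ∈ q.support, z ∈ Q → z = w := by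
  induction p with
  | @nil x => exact ⟨x, hy, .nil, by simp, by simp⟩
  | @cons x v y h p ih =>
    by_cases hx : x ∈ Q
    · exact ⟨x, hx, .nil, by simp, by simp⟩
    · obtain ⟨w, hw, q, hq, hqQ⟩ := ih hy
      refine ⟨w, hw, q.cons h, ?_, fun z hz hzQ => ?_⟩
      · simpa using List.Subset.trans hq (List.subset_cons_self _ _)
      · rw [SimpleGraph.Walk.support_cons, List.mem_cons] at hz
        rcases hz with rfl | hz
        · exact absurd hzQ hx
        · exact hqQ z hz hzQ

/-- A connected set with a neighbour at each of three further vertices contains a tripod with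
these ends. -/
lemma exists_tripod {A : Set W} (hA : (H.induce A).Connected) {x : Fin 3 → W}
    (hx : Function.Injective x) (hxA : ∀ m, x m ∉ A) (hadj : ∀ m, ∃ a ∈ A, H.Adj a (x m)) :
    ∃ a ∈ A, HasFan H A a x := by
  classical
  have hle : (H.induce A).spanningCoe ≤ H.spanningCoe := fun _ _ h => h.2.2
  have hwalk : ∀ y ∈ A, ∀ z ∈ A, ∃ p : H.spanningCoe.Walk y z, ∀ w ∈ p.support, w ∈ A := by
    intro y hy z hz
    obtain ⟨p, hp⟩ := exists_walk_of_connected hA hy hz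
    exact ⟨p.mapLe hle, fun w hw => hp w (by simpa using hw)⟩
  choose b hbA hb' using hadj
  have hb : ∀ m, H.spanningCoe.Adj (b m) (x m) := hb'
  obtain ⟨q₀, hq₀⟩ := hwalk _ (hbA 0) _ (hbA 1)
  set q := q₀.bypass
  have hqA : ∀ w ∈ q.support, w ∈ A := fun w hw => hq₀ w (q₀.support_bypass_subset_support hw)
  obtain ⟨r₀, hr₀⟩ := hwalk _ (hbA 2) _ (hbA 0)
  -- The centre of the tripod is the vertex where a walk from the third attachment first hits a path
  -- between the other two.
  obtain ⟨a, haq, r, hr, hra⟩ := exists_walk_to_first (Q := {z | z ∈ q.support}) r₀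
    q.start_mem_support
  -- walks from the centre to the three attachments
  have hlegs : ∃ p : ∀ m, H.spanningCoe.Walk a (b m), (∀ m, ∀ z ∈ (p m).support, z ∈ A) ∧
      ∀ m m', m ≠ m' → ∀ z ∈ (p m).support, z ∈ (p m').support → z = a := by
    have h0 : ∀ z, z ∈ (q.takeUntil a haq).reverse.support → z ∈ q.support := fun z hz =>
      q.support_takeUntil_subset_support haq (by simpa using hz)
    have h1 : ∀ z, z ∈ (q.dropUntil a haq).support → z ∈ q.support := fun z hz =>
      q.support_dropUntil_subset_support haq hz
    have h2 : ∀ z, z ∈ r.reverse.support → z ∈ r.support := fun z hz => by simpa using hz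
    have h01 : ∀ z, z ∈ (q.takeUntil a haq).reverse.support →
        z ∈ (q.dropUntil a haq).support → z = a := fun z hz hz' =>
      eq_of_mem_takeUntil_of_mem_dropUntil q₀.bypass_isPath haq (by simpa using hz) hz'
    have h02 : ∀ z, z ∈ (q.takeUntil a haq).reverse.support → z ∈ r.reverse.support → z = a :=
      fun z hz hz' => hra z (h2 z hz') (h0 z hz)
    have h12 : ∀ z, z ∈ (q.dropUntil a haq).support → z ∈ r.reverse.support → z = a :=
      fun z hz hz' => hra z (h2 z hz') (h1 z hz)
    refine ⟨Fin.cons (q.takeUntil a haq).reverse (Fin.cons (q.dropUntil a haq)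
      (Fin.cons r.reverse fun i => i.elim0)), ?_, ?_⟩
    · intro m
      fin_cases m
      · exact fun z hz => hqA z (h0 z hz)
      · exact fun z hz => hqA z (h1 z hz)
      · exact fun z hz => hr₀ z (hr (h2 z hz))
    · intro m m' hmm z hz hz'
      fin_cases m <;> fin_cases m'
      · exact absurd rfl hmm
      · exact h01 z hz hz'
      · exact h02 z hz hz'
      · exact h01 z hz' hz
      · exact absurd rfl hmm
      · exact h12 z hz hz'
      · exact h02 z hz' hz
      · exact h12 z hz' hz
      · exact absurd rfl hmm
  obtain ⟨p, hpA, hpd⟩ := hlegs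
  have hmem : ∀ m, ∀ z ∈ ((p m).concat (hb m)).bypass.support, z ∈ (p m).support ∨ z = x m := by
    intro m z hz
    have := SimpleGraph.Walk.support_bypass_subset_support _ hz
    rwa [SimpleGraph.Walk.support_concat, List.mem_append,
      List.mem_singleton] at this
  refine ⟨a, hqA a haq, fun m => ((p m).concat (hb m)).bypass,
    fun m => SimpleGraph.Walk.bypass_isPath _, fun m z hz => (hmem m z hz).imp_left (hpA m z),
    fun m m' hmm z hz hz' => ?_⟩
  rcases hmem m z hz with h | h <;> rcases hmem m' z hz' with h' | h'
  · exact hpd m m' hmm z h h'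
  · exact absurd (h' ▸ hpA m z h) (hxA m')
  · exact absurd (h ▸ hpA m' z h') (hxA m)
  · exact absurd (hx (h.symm.trans h')) hmm

/-- In a 3-connected graph there is a fan from a vertex to any three others. -/
lemma IsThreeConnected.hasFan [Finite W] (hH : IsThreeConnected H) {v : W} (hv : v ∈ H.verts)
    {x : Fin 3 → W} (hx : Function.Injective x) (hxH : ∀ m, x m ∈ H.verts) (hxv : ∀ m, x m ≠ v) :
    HasFan H Set.univ v x := by
  classical
  set G := (H.deleteVerts {v}).spanningCoe with hG
  have hle : G ≤ H.spanningCoe := SimpleGraph.Subgraph.spanningCoe_le_of_le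
    SimpleGraph.Subgraph.deleteVerts_le
  have hlink : Linked G {a | H.Adj v a} (Set.range x) 3 := by
    refine linked_of_forall_separates 3 G _ _ fun S hS => ?_
    by_contra hlt
    -- Connectivity is applied to walks starting at `v`, so `v` must not be deleted. Nothing is
    -- lost, since the path after its first step avoids `v` anyway.
    set S' := S \ {v} with hS'
    have hS'2 : S'.ncard ≤ 2 := (Set.ncard_le_ncard Set.sdiff_subset).trans (by omega)
    have hm : ∃ m, x m ∉ S' := by
      by_contra hcon
      push Not at hcon
      have hle := Set.ncard_le_ncard (s := Set.range x) (t := S')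
        (by rintro _ ⟨m, rfl⟩; exact hcon m)
      rw [← Set.image_univ, Set.ncard_image_of_injective _ hx, Set.ncard_univ] at hle
      simp at hle
      omega
    obtain ⟨m, hm⟩ := hm
    obtain ⟨p, hp⟩ := exists_walk_of_connected (hH.2 S' hS'2) (x := v) (y := x m)
      ⟨hv, fun h => h.2 rfl⟩ ⟨hxH m, hm⟩
    have hpath := p.bypass_isPath
    have hsub : ∀ z ∈ p.bypass.support, z ∉ S' := fun z hz =>
      (hp z (p.support_bypass_subset_support hz)).2
    revert hpath hsub
    cases p.bypass with
    | nil => exact fun _ _ => hxv m rfl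
    | @cons _ a _ h r =>
      intro hpath hsub
      rw [SimpleGraph.Walk.cons_isPath_iff] at hpath
      have hr : ∀ e ∈ r.edges, e ∈ G.edgeSet := by
        intro e he
        induction e with
        | h y z =>
          have hy := r.fst_mem_support_of_mem_edges he
          have hz := r.snd_mem_support_of_mem_edges he
          have hyz : H.Adj y z := SimpleGraph.Subgraph.deleteVerts_le.2 (r.adj_of_mem_edges he)
          have hyv : y ≠ v := fun h => hpath.2 (h ▸ hy)
          have hzv : z ≠ v := fun h => hpath.2 (h ▸ hz)
          simp only [hG, SimpleGraph.mem_edgeSet, SimpleGraph.Subgraph.spanningCoe_adj,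
            SimpleGraph.Subgraph.deleteVerts_adj, Set.mem_singleton_iff]
          exact ⟨hyz.fst_mem, hyv, hyz.snd_mem, hzv, hyz⟩
      obtain ⟨z, hz, hzS⟩ := hS a (SimpleGraph.Subgraph.deleteVerts_le.2 h) _ ⟨m, rfl⟩
        (r.transfer G hr)
      rw [SimpleGraph.Walk.support_transfer] at hz
      exact hsub z (by simp [hz]) ⟨hzS, fun h => hpath.2 (h ▸ hz)⟩
  obtain ⟨a, b, p, -, ha, hb, hd⟩ := hlink
  choose τ hτ using hb
  have hτinj : Function.Injective τ := by
    intro i j hij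
    by_contra hne
    refine hd i j hne _ (p i).end_mem_support ?_
    rw [← hτ i, hij, hτ j]
    exact (p j).end_mem_support
  -- Three disjoint paths end at three different `x m`, so the ends are a permutation of `x`.
  have hτsurj : Function.Surjective τ := Finite.surjective_of_injective hτinj
  choose κ hκ using hτsurj
  have hκinj : Function.Injective κ := fun i j h => by rw [← hκ i, h, hκ j]
  have hend : ∀ m, b (κ m) = x m := fun m => by rw [← hτ, hκ]
  have hmem : ∀ m, ∃ r : H.spanningCoe.Walk v (x m), ∀ z ∈ r.support,
      z = v ∨ z ∈ (p (κ m)).support := by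
    intro m
    have hav : H.spanningCoe.Adj v (a (κ m)) := ha (κ m)
    refine ⟨(((p (κ m)).mapLe hle).copy rfl (hend m)).cons hav, fun z hz => ?_⟩
    simpa using hz
  choose r hr using hmem
  refine ⟨fun m => (r m).bypass, fun m => (r m).bypass_isPath, fun _ _ _ => Or.inl trivial,
    fun m m' hmm z hz hz' => ?_⟩
  rcases hr m z ((r m).support_bypass_subset_support hz) with h | h
  · exact h
  · rcases hr m' z ((r m').support_bypass_subset_support hz') with h' | h'
    · exact h'
    · exact absurd h' (hd _ _ (hκinj.ne hmm) z h)

/-- A fan to the whole boundary of a set stays outside the set. -/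
lemma HasFan.avoid {K : Set W} {v : W} {x : Fin 3 → W} (h : HasFan H Set.univ v x)
    (hxv : ∀ m, x m ≠ v) (hK : ∀ a b, a ∈ K → H.Adj a b → b ∈ K ∨ b ∈ Set.range x)
    (hv : v ∉ K) : HasFan H (K ∪ Set.range x)ᶜ v x := by
  classical
  obtain ⟨p, hp, -, hd⟩ := h
  -- A leg meets the boundary of `K` only at its own end, because every other boundary vertex is the
  -- end of another leg. To enter `K` it would have to cross the boundary before that end.
  have hpx : ∀ m, ∀ z ∈ (p m).support, z ∈ Set.range x → z = x m := by
    rintro m _ hz ⟨m', rfl⟩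
    by_contra hne
    have hmm : m ≠ m' := fun h => hne (h ▸ rfl)
    exact hxv m' (hd m m' hmm _ hz (p m').end_mem_support)
  refine ⟨p, hp, fun m z hz => ?_, hd⟩
  by_contra hcon
  push Not at hcon
  obtain ⟨hzK, hzx⟩ := hcon
  rw [Set.notMem_compl_iff] at hzK
  rcases hzK with hzK | hzr
  · obtain ⟨w, hw, hwx⟩ := exists_mem_support_of_boundary (G := H.spanningCoe) hK
      ((p m).takeUntil z hz) hv hzK
    have := hpx m w ((p m).support_takeUntil_subset_support hz hw) hwx
    exact SimpleGraph.Walk.endpoint_notMem_support_takeUntil (hp m) hz hzx.symm (this ▸ hw)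
  · exact hzx (hpx m z hz hzr)

end Fans

/-! ### Maximality of ferociously strong reductions. -/

section FerociouslyStrong

variable {W : Type u} {H J J' : VGraph W} {C : Root ↪ W}

lemma IsComponent.induce_connected {K : VGraph W} {U : Set W} (h : IsComponent K U) :
    (K.induce U).Connected := by
  obtain ⟨c, rfl⟩ := h
  rw [SimpleGraph.Subgraph.connected_iff]
  refine ⟨⟨?_⟩, c.nonempty_supp.image _⟩
  rintro ⟨_, x, hx, rfl⟩ ⟨_, y, hy, rfl⟩
  obtain ⟨p⟩ := SimpleGraph.ConnectedComponent.exact (hx.trans hy.symm)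
  induction p with
  | nil => exact SimpleGraph.Reachable.refl _
  | @cons x z y hxz p ih =>
    have hz : z ∈ c.supp := c.mem_supp_of_adj_mem_supp hx hxz
    refine SimpleGraph.Reachable.trans (SimpleGraph.Adj.reachable ?_) (ih hz hy)
    exact ⟨⟨x, hx, rfl⟩, ⟨z, hz, rfl⟩, hxz⟩

lemma AttachesAt.induce_connected {U X : Set W} (h : AttachesAt H J U X) :
    (H.induce U).Connected :=
  h.1.induce_connected.mono (SimpleGraph.Subgraph.induce_mono_left
    SimpleGraph.Subgraph.deleteVerts_le) rfl

lemma IsReduction.exists_separator_eq_range (hJ : IsReduction H C J) {U X : Set W}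
    (h : AttachesAt H J U X) : ∃ x : Fin 3 → W, Function.Injective x ∧ Set.range x = X := by
  obtain ⟨x, y, z, rfl, hxy, hyz, hxz⟩ := hJ.triangle U X h
  refine ⟨![x, y, z], ?_, ?_⟩
  · intro i j hij
    have h₁ : x ≠ y := J.adj_sub hxy
    have h₂ : y ≠ z := J.adj_sub hyz
    have h₃ : x ≠ z := J.adj_sub hxz
    fin_cases i <;> fin_cases j <;> simp [h₁, h₂, h₃, h₁.symm, h₂.symm, h₃.symm] at hij ⊢
  · ext w
    simp only [Matrix.range_cons, Matrix.range_empty, Set.union_empty, Set.singleton_union]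

/-- Two disjoint connected sets in the interior of a separator, both with an edge to each vertex
of the separator, contain no vertex of a strong planar reduction. -/
lemma disjoint_verts_of_two_sides [Finite W] (hH : IsThreeConnected H) (hC : RootNeighbors H C)
    (hJ : IsReduction H C J) (hJ' : IsStrongPlanarReduction H C J') {U₀ X : Set W}
    (hX : AttachesAt H J U₀ X) {A B : Set W} (hA : (H.induce A).Connected)
    (hB : (H.induce B).Connected) (hAB : Disjoint A B) (hAX : A ⊆ interior H J X)
    (hBX : B ⊆ interior H J X) (hxA : ∀ x ∈ X, ∃ a ∈ A, H.Adj a x)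
    (hxB : ∀ x ∈ X, ∃ b ∈ B, H.Adj b x) : Disjoint (A ∪ B) J'.verts := by
  obtain ⟨x, hx, rfl⟩ := hJ.exists_separator_eq_range hX
  set K := interior H J (Set.range x) with hK
  have hKb : ∀ a b, a ∈ K → H.Adj a b → b ∈ K ∨ b ∈ Set.range x :=
    fun a b ha hab => interior_boundary ha hab
  have hKx : Disjoint K (Set.range x) := interior_disjoint hX.subset_verts
  have hxK : ∀ m, x m ∉ K := fun m h => Set.disjoint_left.1 hKx h ⟨m, rfl⟩
  have hvX : C .vstar ∉ Set.range x := hC.vstar_notMem hJ hX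
  have hvK : C .vstar ∉ K := by
    rintro ⟨U, hU, hv⟩
    exact hU.notMem hv (hJ.root_mem _)
  have hxv : ∀ m, x m ≠ C .vstar := fun m h => hvX ⟨m, h⟩
  have hfan := (hH.hasFan (hJ.verts_subset (hJ.root_mem .vstar)) hx
    (fun m => hJ.verts_subset (hX.subset_verts ⟨m, rfl⟩)) hxv).avoid hxv hKb hvK
  obtain ⟨a, ha, hafan⟩ := exists_tripod hA hx (fun m h => hxK m (hAX h)) fun m => hxA _ ⟨m, rfl⟩
  obtain ⟨b, hb, hbfan⟩ := exists_tripod hB hx (fun m h => hxK m (hBX h)) fun m => hxB _ ⟨m, rfl⟩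
  -- The three left centers lie in disjoint regions: `v*` outside `X` and its interior, the other
  -- two in `A` and `B`. The right centers are the vertices of `X`.
  let Z : Fin 3 → Set W := ![(K ∪ Set.range x)ᶜ, A, B]
  have hZA : Disjoint (Z 0) A := Set.disjoint_left.2 fun z hz hzA => hz (Or.inl (hAX hzA))
  have hZB : Disjoint (Z 0) B := Set.disjoint_left.2 fun z hz hzB => hz (Or.inl (hBX hzB))
  have hZ : ∀ i i', i ≠ i' → Disjoint (Z i) (Z i') := by
    intro i i' hi
    fin_cases i <;> fin_cases i'
    · exact absurd rfl hi
    · exact hZA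
    · exact hZB
    · exact hZA.symm
    · exact absurd rfl hi
    · exact hAB
    · exact hZB.symm
    · exact hAB.symm
    · exact absurd rfl hi
  have hZx : ∀ i m, x m ∉ Z i := by
    intro i m h
    fin_cases i
    · exact h (Or.inr ⟨m, rfl⟩)
    · exact hxK m (hAX h)
    · exact hxK m (hBX h)
  obtain ⟨S, hSl, hSr, hSZ⟩ := exists_subdivision_of_fans (F := H) (Z := Z)
    (a := ![C .vstar, a, b]) hx (by
      intro i
      fin_cases i
      · exact hfan
      · exact hafan
      · exact hbfan) (by
      intro i
      fin_cases i
      · rintro (h | h)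
        · exact hvK h
        · exact hvX h
      · exact ha
      · exact hb) hZ hZx
  have hinter : ∀ i, Z i ∩ S.verts = S.openStar i := by
    intro i
    ext z
    constructor
    · rintro ⟨hzi, i', m, hz⟩
      rcases hSZ i' m z hz with h | h
      · have hii : i' = i := by
          by_contra hne
          exact Set.disjoint_left.1 (hZ i' i hne) h hzi
        subst hii
        exact ⟨m, hz, fun h' => hZx i' m (by rw [← hSr, ← h']; exact hzi)⟩
      · exact absurd (h ▸ hzi) (hZx i m)
    · rintro ⟨m, hz, hne⟩
      exact ⟨(hSZ i m z hz).resolve_right fun h => hne (by rw [hSr, h]), i, m, hz⟩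
  have hKH : K ⊆ H.verts := by
    rintro z ⟨U, hU, hz⟩
    exact hU.mem_verts hz
  have hind : ∀ A' : Set W, A' ⊆ K → H.induce A' ≤ H := fun A' h =>
    ⟨fun z hz => hKH (h hz), fun _ _ hadj => hadj.2.2⟩
  obtain ⟨M, hM⟩ := hJ'
  -- Part (2) is applied to `J'`, although the subdivision was built from `J`; it places `A` and `B`
  -- in components of `H - V(J')`.
  obtain ⟨X', -, ⟨U₁, hU₁, hAU⟩, U₂, hU₂, hBU⟩ := exists_triangle_two_sides hC S (i := 0) (j := 1)
    (k := 2) (by decide) (by decide) (by rw [hSl]; rfl) (hind A hAX) (hind B hBX) hA hB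
    (hinter 1) (hinter 2) hM
  rw [Set.disjoint_left]
  rintro z (hz | hz)
  · exact hU₁.notMem (hAU hz)
  · exact hU₂.notMem (hBU hz)

/-- The second corollary, for 3-connected graphs in which `v*` only has root vertices as
neighbours. -/
theorem verts_subset_of_ferociouslyStrong [Finite W] (hH : IsThreeConnected H)
    (hC : RootNeighbors H C) (hJ : IsFerociouslyStrongPlanarReduction H C J)
    (hJ' : IsStrongPlanarReduction H C J') : J'.verts ⊆ J.verts := by
  intro w hw
  by_contra hwJ
  obtain ⟨⟨M, hM⟩, hfer⟩ := hJ
  obtain ⟨M', hM'⟩ := id hJ'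
  obtain ⟨U, X, hU, hwU⟩ := exists_attachesAt (hM'.1.verts_subset hw) hwJ
  -- The two sides are two components with the same separator, or the two parts of a single one. In
  -- both cases they cover `w`.
  rcases hfer U X hU with ⟨U', hne, hU'⟩ | ⟨A, B, rfl, hAB, hA, hB, hX⟩
  · have hdisj : Disjoint U U' := by
      rw [Set.disjoint_left]
      exact fun z hz hz' => hne (hU.eq_of_mem hU' hz hz').1.symm
    exact Set.disjoint_left.1 (disjoint_verts_of_two_sides hH hC hM.1 hJ' hU hU.induce_connected
      hU'.induce_connected hdisj (fun z hz => ⟨U, hU, hz⟩) (fun z hz => ⟨U', hU', hz⟩)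
      (fun x hx => hU.exists_adj hx) fun x hx => hU'.exists_adj hx) (Or.inl hwU) hw
  · exact Set.disjoint_left.1 (disjoint_verts_of_two_sides hH hC hM.1 hJ' hU hA hB hAB
      (fun z hz => ⟨_, hU, Or.inl hz⟩) (fun z hz => ⟨_, hU, Or.inr hz⟩)
      (fun x hx => (hX x hx).1) fun x hx => (hX x hx).2) hwU hw

end FerociouslyStrong

end TwoDRP

open TwoDRP in
theorem mainTheorem9 :
    -- the lemma: five of the six centers of a subdivision in a compaction
    (∀ {W : Type v} [Finite W] (F : VGraph W) (C : Root ↪ W),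
      IsCompactionOfRootGraph.{u, v} F C →
      ∀ (S : K33Subdivision F) (J : VGraph W) (M : PlanarEmbedding J),
        IsStrongPlanarReductionWith F C J M →
        ∃ X : Set W, M.IsTriangularFace X ∧
          5 ≤ (S.centers ∩ (X ∪ ⋃₀ {U | AttachesAt F J U X})).ncard) ∧
    -- the first corollary; the side of the subdivision containing `v*` is called `left`
    (∀ {W : Type v} [Finite W] (F : VGraph W) (C : Root ↪ W),
      IsReductionOfRootGraph F C ∨ IsCompactionOfRootGraph.{u, v} F C →
      ∀ (S : K33Subdivision F) (i j k : Fin 3), i ≠ j → i ≠ k → j ≠ k →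
        S.left i = C Root.vstar →
        ∀ A B : VGraph W, A ≤ F → B ≤ F → A.Connected → B.Connected → Disjoint A.verts B.verts →
          A.verts ∩ S.verts = S.openStar j → B.verts ∩ S.verts = S.openStar k →
        ∀ (J : VGraph W) (M : PlanarEmbedding J), IsStrongPlanarReductionWith F C J M →
          ∃ X : Set W, M.IsTriangularFace X ∧
            (∃ U, AttachesAt F J U X ∧ A.verts ⊆ U) ∧
            (∃ U, AttachesAt F J U X ∧ B.verts ⊆ U)) ∧
    -- the second corollary
    (∀ {W : Type v} [Finite W] (H : VGraph W) (C : Root ↪ W),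
      IsReductionOfRootGraph H C ∨ IsCompactionOfRootGraph.{u, v} H C →
      ∀ J : VGraph W, IsFerociouslyStrongPlanarReduction H C J →
        IsStrongPlanarReduction H C J ∧
          ∀ J' : VGraph W, IsStrongPlanarReduction H C J' → J'.verts ⊆ J.verts) := by
  refine ⟨?_, ?_, ?_⟩
  · intro W _ F C _ S J M h
    obtain ⟨X, hX, -, h5⟩ := exists_triangle_five_centers h S
    exact ⟨X, hX, h5⟩
  · intro W _ F C hF S i j k hij hik _ hi A B hAF hBF hA hB _ hAS hBS J M h
    exact exists_triangle_two_sides (rootNeighbors_of_reduction_or_compaction hF) S hij hik hi hAF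
      hBF hA hB hAS hBS h
  · intro W _ H C hH J hJ
    exact ⟨hJ.1, fun J' hJ' => verts_subset_of_ferociouslyStrong
      (threeConnected_of_reduction_or_compaction hH) (rootNeighbors_of_reduction_or_compaction hH)
      hJ hJ'⟩
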